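/- **Theorem (characterizations of classical orthogonal polynomial sequences).** Let $\mathcal P=\mathbb C[x]$, $\mathcal P_m$ the space of polynomials of degree at most $m$, and $\mathcal P'$ the space of linear functionals on $\mathcal P$. For ${\bf u}\in\mathcal P'$ and $\phi\in\mathcal P$ define $\langle\phi{\bf u},p\rangle:=\langle{\bf u},\phi p\rangle$, $\langle D{\bf u},p\rangle:=-\langle{\bf u},p'\rangle$, and $u_n:=\langle{\bf u},x^n\rangle$. A sequence $\{P_n\}_{n\ge0}$ with $\deg P_n=n$ is an orthogonal polynomial sequence (OPS) with respect to ${\bf u}$ if $\langle{\bf u},P_mP_n\rangle=h_n\delta_{m,n}$ with all $h_n\ne0$; it is called an OPS if it is one with respect to some functional; ${\bf u}$ is regular if it has an OPS. Set $P_n^{[k]}:=\frac{1}{(n+1)_k}\frac{{\rm d}^k}{{\rm d}x^k}P_{n+k}$, where $(n+1)_k=(n+1)(n+2)\cdots(n+k)$, and $P_{-1}:=0$. For $\phi(x)=ax^2+bx+c\in\mathcal P_2$ and $\psi(x)=px+q\in\mathcal P_1$ write $d_n:=na+p$ and $e_n:=nb+q$ $(n\in\mathbb Z)$; the pair $(\phi,\psi)$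 is admissible if $d_n\ne0$ for all $n\ge0$. Let ${\bf u}\in\mathcal P'$ be regular, with monic OPS $\{P_n\}_{n\ge0}$. The following are equivalent: * **C1.** There are nonzero $\phi\in\mathcal P_2$, $\psi\in\mathcal P_1$ such that $D(\phi{\bf u})=\psi{\bf u}$. * **C1′.** There is an admissible pair $(\phi,\psi)$ such that $D(\phi{\bf u})=\psi{\bf u}$. * **C2.** There are $\phi\in\mathcal P_2$ and $a_n,b_n,c_n\in\mathbb C$, with $c_n\ne0$ for $n\ge1$, such that $\phi P_n'=a_nP_{n+1}+b_nP_n+c_nP_{n-1}$ for $n\ge0$. * **C3.** $\{P_n^{[k]}\}_{n\ge0}$ is a monic OPS for some $k\ge1$. * **C3′.** $\{P_n^{[k]}\}_{n\ge0}$ is a monic OPS for every $k\ge1$. * **C4.** There are $k\ge1$ and $r_n^{[k]},s_n^{[k]}\in\mathbb C$ such that $P_n^{[k-1]}=P_n^{[k]}+r_n^{[k]}P_{n-1}^{[k]}+s_n^{[k]}P_{n-2}^{[k]}$ for $n\ge2$. * **C4′.** For every $k\ge1$ there are $r_n^{[k]},s_n^{[k]}\in\mathbb C$ such that the relation in C4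 holds for $n\geq2$. * **C5.** There are polynomials $\phi,\psi$ and $\lambda_n\in\mathbb C$, with $\lambda_n\ne0$ for $n\ge1$, such that $\phi P_n''+\psi P_n'+\lambda_nP_n=0$ for $n\ge0$. * **C6.** There is an admissible pair $(\phi,\psi)$ such that the formal series $S_{\bf u}(z):=-\sum_{n\ge0}u_nz^{-n-1}$ satisfies $\phi S_{\bf u}'=(\psi-\phi')S_{\bf u}+(\psi'-\tfrac12\phi'')u_0$. * **C7.** There are an admissible pair $(\phi,\psi)$ and $h_n,t_n\in\mathbb C$ such that $\phi(P_nP_{n-1})'=h_nP_n^2-(\psi-\phi')P_nP_{n-1}+t_nP_{n-1}^2$ for $n\ge1$. * **C8.** There are $\phi\in\mathcal P_2$ and nonzero $k_n\in\mathbb C$ such that $P_n{\bf u}=k_nD^n(\phi^n{\bf u})$ for $n\ge0$. Moreover, the polynomials are the same in all these properties: given polynomials $\phi,\psi$, each of C1, C1′, C5, C6, C7 holds with the pair $(\phi,\psi)$ if and only if any other of them does; and given $\phi$, each of C2 and C8 holds with $\phi$ if and only if C1 holds with $\phi$ and some $\psi$. In addition, $\{P_n\}$ satisfies $P_0=1$,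 $P_{n+1}=(x-\beta_n)P_n-\gamma_nP_{n-1}$ $(n\ge0)$ with $\beta_n,\gamma_n\in\mathbb{C}$ and $\gamma_n\ne0$ for $n\ge1$, and, whenever C1 holds with $\phi(x)=ax^2+bx+c$ and $\psi(x)=px+q$, $$\beta_0=-\frac{e_0}{d_0},\qquad \beta_n=-\frac{d_{-2}q+2bnd_{n-1}}{d_{2n}d_{2n-2}}\ (n\ge1),$$ $$\gamma_1=-\frac1{d_1}\,\phi\Big(-\frac{e_0}{d_0}\Big),\qquad \gamma_n=-\frac{nd_{n-2}}{d_{2n-3}d_{2n-1}}\,\phi\Big(-\frac{e_{n-1}}{d_{2n-2}}\Big)\ (n\ge2),$$ and with these $\phi,\psi$ the relations in C2, C4 (for $k=1$), C5, C7, C8 hold exactly for the parameters $$a_n=na,\quad b_n=-\tfrac12\psi(\beta_n)\ (n\geq0),\quad c_n=-d_{n-1}\gamma_n\ (n\ge1;\ c_0\text{ is arbitrary}),$$ $$r_n^{[1]}=\tfrac12\frac{\psi(\beta_n)}{d_{n-1}},\quad s_n^{[1]}=-\frac{(n-1)a}{d_{n-2}}\gamma_n\ (n\ge2),\qquad \lambda_n=-nd_{n-1}\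 (n\ge0),$$ $$h_n=d_{2n-3},\quad t_n=-d_{2n-1}\gamma_n\ (n\ge1),\qquad k_n=\prod_{i=0}^{n-1}d_{n+i-1}^{-1}\ (n\ge0).$$ -/

import Mathlib

open Polynomial

noncomputable section

namespace ClassicalOPS

/-! Basic operations on polynomials and on linear functionals.  The space of polynomials carries
its strict inductive limit topology, for which every linear functional is continuous, so the
functionals are exactly the elements of `Module.Dual ℂ ℂ[X]`. -/

/-- Left multiplication of a functional by a polynomial: `⟨φ u, p⟩ = ⟨u, φ p⟩`. -/
def leftMul (φ : ℂ[X]) (u : Module.Dual ℂ ℂ[X]) : Module.Dual ℂ ℂ[X] :=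
  u.comp (LinearMap.mulLeft ℂ φ)

/-- Distributional derivative of a functional: `⟨D u, p⟩ = -⟨u, p'⟩`. -/
def distDeriv (u : Module.Dual ℂ ℂ[X]) : Module.Dual ℂ ℂ[X] :=
  -(u.comp (Polynomial.derivative (R := ℂ)))

/-- The moments `u_n = ⟨u, x^n⟩`. -/
def moment (u : Module.Dual ℂ ℂ[X]) (n : ℕ) : ℂ := u (X ^ n)

/-- `P` is an orthogonal polynomial sequence with respect to `u`. -/
def IsOPS (u : Module.Dual ℂ ℂ[X]) (P : ℕ → ℂ[X]) : Prop :=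
  (∀ n, (P n).degree = n) ∧
    ∃ h : ℕ → ℂ, (∀ n, h n ≠ 0) ∧ ∀ m n, u (P m * P n) = if m = n then h n else 0

/-- `P` is a monic orthogonal polynomial sequence with respect to `u`. -/
def IsMonicOPS (u : Module.Dual ℂ ℂ[X]) (P : ℕ → ℂ[X]) : Prop :=
  IsOPS u P ∧ ∀ n, (P n).Monic

/-- `u` is regular (quasi-definite). -/
def IsRegular (u : Module.Dual ℂ ℂ[X]) : Prop := ∃ P : ℕ → ℂ[X], IsOPS u P

/-- The sequence `n ↦ P_{n-1}`, with the convention `P_{-1} = 0`. -/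
def prev (P : ℕ → ℂ[X]) : ℕ → ℂ[X]
  | 0 => 0
  | n + 1 => P n

/-- The three-term recurrence relation `P_{n+1} = (x - β_n) P_n - γ_n P_{n-1}`, `n ≥ 0`
(`P_{-1} = 0`, `P_0 = 1`). -/
def TTRR (P : ℕ → ℂ[X]) (β γ : ℕ → ℂ) : Prop :=
  P 0 = 1 ∧ ∀ n, P (n + 1) = (X - C (β n)) * P n - C (γ n) * prev P n

/-- The normalized derivatives `P_n^{[k]} = (d^k/dx^k) P_{n+k} / (n+1)_k`, where
`(n+1)_k = (n+1)(n+2)⋯(n+k)`. -/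
def normDeriv (P : ℕ → ℂ[X]) (k n : ℕ) : ℂ[X] :=
  (((n + 1).ascFactorial k : ℕ) : ℂ)⁻¹ • (derivative^[k] (P (n + k)))

/-- `d_n = n a + p`, where `φ = a x² + b x + c` and `ψ = p x + q`. -/
def dCoef (φ ψ : ℂ[X]) (n : ℤ) : ℂ := n * φ.coeff 2 + ψ.coeff 1

/-- `e_n = n b + q`, where `φ = a x² + b x + c` and `ψ = p x + q`. -/
def eCoef (φ ψ : ℂ[X]) (n : ℤ) : ℂ := n * φ.coeff 1 + ψ.coeff 0

/-- Admissible pairs: `deg φ ≤ 2`, `deg ψ ≤ 1`, and the constant `ψ' + (n/2) φ'' = d_n` is nonzero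
for every `n ≥ 0`. -/
def Admissible (φ ψ : ℂ[X]) : Prop :=
  φ.natDegree ≤ 2 ∧ ψ.natDegree ≤ 1 ∧ ∀ n : ℕ, dCoef φ ψ n ≠ 0

/-! Formal series in `1/z`, as Laurent series in the variable `w = 1/z`. -/

/-- A polynomial in `z`, as a Laurent series in `w = 1/z`. -/
def polyInZ (p : ℂ[X]) : LaurentSeries ℂ :=
  p.eval₂ HahnSeries.C (HahnSeries.single (-1 : ℤ) (1 : ℂ))

/-- The formal derivative `d/dz = -w² d/dw`. -/
def zDeriv (f : LaurentSeries ℂ) : LaurentSeries ℂ :=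
  -(HahnSeries.single (2 : ℤ) (1 : ℂ) * LaurentSeries.derivative ℂ f)

/-- The formal Stieltjes series `S_u(z) = -∑ u_n / z^{n+1}`. -/
def stieltjes (u : Module.Dual ℂ ℂ[X]) : LaurentSeries ℂ :=
  -(HahnSeries.single (1 : ℤ) (1 : ℂ) * HahnSeries.ofPowerSeries ℤ ℂ (PowerSeries.mk (moment u)))

/-! The properties, first for given polynomials `φ`, `ψ`. -/

/-- Pearson's equation `D(φ u) = ψ u`. -/
def Pearson (u : Module.Dual ℂ ℂ[X]) (φ ψ : ℂ[X]) : Prop :=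
  distDeriv (leftMul φ u) = leftMul ψ u

/-- Pearson's equation, with nonzero `φ`, `ψ` of degrees at most two and one. -/
def C1At (u : Module.Dual ℂ ℂ[X]) (φ ψ : ℂ[X]) : Prop :=
  φ ≠ 0 ∧ φ.natDegree ≤ 2 ∧ ψ ≠ 0 ∧ ψ.natDegree ≤ 1 ∧ Pearson u φ ψ

/-- Pearson's equation, with an admissible pair. -/
def C1At' (u : Module.Dual ℂ ℂ[X]) (φ ψ : ℂ[X]) : Prop :=
  Admissible φ ψ ∧ Pearson u φ ψ

/-- The equation `φ P_n' = a_n P_{n+1} + b_n P_n + c_n P_{n-1}`, for one index `n`. -/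
def StructureEq (P : ℕ → ℂ[X]) (φ : ℂ[X]) (n : ℕ) (a b c : ℂ) : Prop :=
  φ * derivative (P n) = C a * P (n + 1) + C b * P n + C c * prev P n

/-- The structure relation of Al-Salam and Chihara. -/
def C2At (P : ℕ → ℂ[X]) (φ : ℂ[X]) : Prop :=
  φ.natDegree ≤ 2 ∧ ∃ a b c : ℕ → ℂ, (∀ n, 1 ≤ n → c n ≠ 0) ∧
    ∀ n, StructureEq P φ n (a n) (b n) (c n)

/-- The sequence of normalized derivatives of order `k` is a monic OPS (for some functional). -/
def C3At (P : ℕ → ℂ[X]) (k : ℕ) : Prop :=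
  ∃ v : Module.Dual ℂ ℂ[X], IsMonicOPS v (normDeriv P k)

/-- The equation `P_n^{[k-1]} = P_n^{[k]} + r P_{n-1}^{[k]} + s P_{n-2}^{[k]}`, to be used for
`k ≥ 1` and `n ≥ 2`. -/
def DerivEq (P : ℕ → ℂ[X]) (k n : ℕ) (r s : ℂ) : Prop :=
  normDeriv P (k - 1) n =
    normDeriv P k n + C r * normDeriv P k (n - 1) + C s * normDeriv P k (n - 2)

/-- The three-term relation between normalized derivatives of orders `k - 1` and `k`. -/
def C4At (P : ℕ → ℂ[X]) (k : ℕ) : Prop :=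
  ∃ r s : ℕ → ℂ, ∀ n, 2 ≤ n → DerivEq P k n (r n) (s n)

/-- The equation `φ P_n'' + ψ P_n' + l P_n = 0`, for one index `n`. -/
def BochnerEq (P : ℕ → ℂ[X]) (φ ψ : ℂ[X]) (n : ℕ) (l : ℂ) : Prop :=
  φ * derivative (derivative (P n)) + ψ * derivative (P n) + C l * P n = 0

/-- Bochner's differential equation. -/
def C5At (P : ℕ → ℂ[X]) (φ ψ : ℂ[X]) : Prop :=
  ∃ l : ℕ → ℂ, (∀ n, 1 ≤ n → l n ≠ 0) ∧ ∀ n, BochnerEq P φ ψ n (l n)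

/-- Maroni's equation `φ S_u' = (ψ - φ') S_u + (ψ' - φ''/2) u_0`, with an admissible pair. -/
def C6At (u : Module.Dual ℂ ℂ[X]) (φ ψ : ℂ[X]) : Prop :=
  Admissible φ ψ ∧
    polyInZ φ * zDeriv (stieltjes u) =
      polyInZ (ψ - derivative φ) * stieltjes u +
        polyInZ ((derivative ψ - C (1 / 2) * derivative (derivative φ)) * C (moment u 0))

/-- The equation `φ (P_n P_{n-1})' = h P_n² - (ψ - φ') P_n P_{n-1} + t P_{n-1}²`, to be used for
`n ≥ 1`. -/
def McCarthyEq (P : ℕ → ℂ[X]) (φ ψ : ℂ[X]) (n : ℕ) (h t : ℂ) : Prop :=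
  φ * derivative (P n * P (n - 1)) =
    C h * P n ^ 2 - (ψ - derivative φ) * (P n * P (n - 1)) + C t * P (n - 1) ^ 2

/-- McCarthy's relation, with an admissible pair. -/
def C7At (P : ℕ → ℂ[X]) (φ ψ : ℂ[X]) : Prop :=
  Admissible φ ψ ∧ ∃ h t : ℕ → ℂ, ∀ n, 1 ≤ n → McCarthyEq P φ ψ n (h n) (t n)

/-- The equation `P_n u = κ D^n(φ^n u)`, for one index `n`. -/
def RodriguesEq (u : Module.Dual ℂ ℂ[X]) (P : ℕ → ℂ[X]) (φ : ℂ[X]) (n : ℕ) (κ : ℂ) : Prop :=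
  leftMul (P n) u = κ • (distDeriv^[n] (leftMul (φ ^ n) u))

/-- The distributional Rodrigues formula. -/
def C8At (u : Module.Dual ℂ ℂ[X]) (P : ℕ → ℂ[X]) (φ : ℂ[X]) : Prop :=
  φ.natDegree ≤ 2 ∧ ∃ κ : ℕ → ℂ, (∀ n, κ n ≠ 0) ∧ ∀ n, RodriguesEq u P φ n (κ n)

end ClassicalOPS

end

open ClassicalOPS

namespace ClassicalOPS

variable {u : Module.Dual ℂ ℂ[X]} {P : ℕ → ℂ[X]} {φ ψ : ℂ[X]}

/-! Everything starts from the tested form of Pearson's equation, `u (φ * q' + ψ * q) = 0` for all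
`q`. Put `L q = φ q'' + ψ q'`. Testing with `p' q` gives `u (L p * q) = -u (φ * p' * q')`, so `L` is
symmetric for `u`. Since `L` does not raise degrees, it is triangular in powers of `x`, and the
`P_n` must be its eigenvectors, with eigenvalue `n d_{n-1}`. If some `d_n` vanished, `φ P_{n+1}'`
would be `u`-orthogonal to every derivative, hence to every polynomial, and so would be zero. This
is how admissibility comes for free.

From the eigenvalue equation the consequences of C1 follow. Differentiating it `k` times and
integrating by parts moves between `φ^k u` and `φ^(k+1) u` (`apply_pow_succ_mul`); this yields the
orthogonality of the derivatives and the Rodrigues formula. Comparing its two subleading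
coefficients gives `β_n` and `γ_n`. Pairing `φ P_n'` with each `P_j` gives the structure relation,
and two consecutive structure relations give McCarthy's relation.

Conversely, a functional killing `P_n` for `n ≥ N` is `f u` with `deg f < N` (`exists_eq_leftMul`).
C2 and C7 show that `D(φ u)` kills `P_n` for `n ≥ 2`, which is Pearson's equation with some `ψ`; C5
and C8 give it almost directly, and C6 is the moment form of it.

The hard implication is from C4 to C1 (`c1At_of_c4At`), where no `φ` is given. An antiderivative of
`P_{m+1} u` turns out to be a polynomial multiple `F_m u`, so the ideal of all `φ` for which `D(φ
u)` is a multiple of `u` is nonzero. If its generator or the associated `ψ` had too large a degree,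
the cofactors of the `F_m` would have strictly decreasing degrees forever. -/

@[simp] lemma leftMul_apply (φ : ℂ[X]) (u : Module.Dual ℂ ℂ[X]) (p : ℂ[X]) :
    leftMul φ u p = u (φ * p) := rfl

@[simp] lemma distDeriv_apply (u : Module.Dual ℂ ℂ[X]) (p : ℂ[X]) :
    distDeriv u p = -u (derivative p) := rfl

lemma map_C_mul (u : Module.Dual ℂ ℂ[X]) (c : ℂ) (p : ℂ[X]) : u (C c * p) = c * u p := by
  rw [← smul_eq_C_mul, map_smul, smul_eq_mul]

lemma pearson_iff {φ ψ : ℂ[X]} :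
    Pearson u φ ψ ↔ ∀ q : ℂ[X], u (φ * derivative q + ψ * q) = 0 := by
  constructor
  · intro h q
    have := LinearMap.congr_fun h q
    simp only [distDeriv_apply, leftMul_apply] at this
    rw [map_add, ← this]
    ring
  · intro h
    refine LinearMap.ext fun q => ?_
    have := h q
    rw [map_add] at this
    simp only [distDeriv_apply, leftMul_apply]
    linear_combination -this

/-! ### Expansions in an orthogonal basis -/

namespace IsMonicOPS

lemma monic (hP : IsMonicOPS u P) (n : ℕ) : (P n).Monic := hP.2 n

lemma degree_eq (hP : IsMonicOPS u P) (n : ℕ) : (P n).degree = n := hP.1.1 n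

lemma natDegree_eq (hP : IsMonicOPS u P) (n : ℕ) : (P n).natDegree = n :=
  natDegree_eq_of_degree_eq_some (hP.degree_eq n)

lemma ne_zero (hP : IsMonicOPS u P) (n : ℕ) : P n ≠ 0 := (hP.monic n).ne_zero

lemma coeff_self (hP : IsMonicOPS u P) (n : ℕ) : (P n).coeff n = 1 := by
  have := (hP.monic n).coeff_natDegree
  rwa [hP.natDegree_eq] at this

lemma coeff_of_lt (hP : IsMonicOPS u P) {n m : ℕ} (h : n < m) : (P n).coeff m = 0 :=
  coeff_eq_zero_of_natDegree_lt (by rwa [hP.natDegree_eq])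

lemma zero_eq (hP : IsMonicOPS u P) : P 0 = 1 :=
  (hP.monic 0).natDegree_eq_zero.1 (hP.natDegree_eq 0)

lemma apply_mul_of_ne (hP : IsMonicOPS u P) {m n : ℕ} (h : m ≠ n) : u (P m * P n) = 0 := by
  obtain ⟨k, -, hk⟩ := hP.1.2
  rw [hk, if_neg h]

lemma norm_ne_zero (hP : IsMonicOPS u P) (n : ℕ) : u (P n * P n) ≠ 0 := by
  obtain ⟨k, hk0, hk⟩ := hP.1.2
  rw [hk, if_pos rfl]
  exact hk0 n

lemma degree_sub_lt (hP : IsMonicOPS u P) {n : ℕ} {q : ℂ[X]} (hq : q.degree < (n + 1 : ℕ)) :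
    (q - C (q.coeff n) * P n).degree < n := by
  rw [degree_lt_iff_coeff_zero] at hq ⊢
  intro m hm
  rw [coeff_sub, coeff_C_mul]
  rcases hm.eq_or_lt with rfl | hm
  · rw [hP.coeff_self]; ring
  · rw [hP.coeff_of_lt hm, hq m hm]; ring

lemma apply_mul_of_degree_lt (hP : IsMonicOPS u P) {n : ℕ} {q : ℂ[X]} (hq : q.degree < n) :
    u (q * P n) = 0 := by
  suffices H : ∀ N, N ≤ n → ∀ q : ℂ[X], q.degree < N → u (q * P n) = 0 from H n le_rfl q hq
  intro N
  induction N with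
  | zero =>
    intro _ q hq
    have : q = 0 := by simpa using hq
    simp [this]
  | succ N ih =>
    intro hN q hq
    have h1 := ih (by omega) _ (hP.degree_sub_lt hq)
    rw [sub_mul, map_sub, mul_assoc, map_C_mul, hP.apply_mul_of_ne (by omega)] at h1
    simpa using h1

lemma apply_mul (hP : IsMonicOPS u P) {n : ℕ} {q : ℂ[X]} (hq : q.degree < (n + 1 : ℕ)) :
    u (q * P n) = q.coeff n * u (P n * P n) := by
  have h1 := hP.apply_mul_of_degree_lt (hP.degree_sub_lt hq)
  rw [sub_mul, map_sub, mul_assoc, map_C_mul] at h1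
  linear_combination h1

lemma apply_eq_zero (hP : IsMonicOPS u P) {n : ℕ} (hn : 1 ≤ n) : u (P n) = 0 := by
  have := hP.apply_mul_of_degree_lt (n := n) (q := 1) (by rw [degree_one]; exact_mod_cast hn)
  rwa [one_mul] at this

lemma apply_mul_natDegree_ne_zero (hP : IsMonicOPS u P) {q : ℂ[X]} (hq : q ≠ 0) :
    u (q * P q.natDegree) ≠ 0 := by
  rw [hP.apply_mul (by rw [degree_eq_natDegree hq]; exact_mod_cast Nat.lt_succ_self _)]
  exact mul_ne_zero (leadingCoeff_ne_zero.2 hq) (hP.norm_ne_zero _)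

lemma eq_zero_of_forall (hP : IsMonicOPS u P) {q : ℂ[X]} (h : ∀ j, u (q * P j) = 0) : q = 0 := by
  by_contra hq
  exact hP.apply_mul_natDegree_ne_zero hq (h _)

lemma leftMul_injective (hP : IsMonicOPS u P) {f g : ℂ[X]} (h : leftMul f u = leftMul g u) :
    f = g := by
  refine sub_eq_zero.1 (hP.eq_zero_of_forall fun j => ?_)
  have := LinearMap.congr_fun h (P j)
  simp only [leftMul_apply] at this
  rw [sub_mul, map_sub, this, sub_self]

lemma dual_ext (hP : IsMonicOPS u P) {v w : Module.Dual ℂ ℂ[X]} (h : ∀ n, v (P n) = w (P n)) :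
    v = w := by
  suffices H : ∀ N : ℕ, ∀ q : ℂ[X], q.degree < N → v q = w q by
    refine LinearMap.ext fun q => ?_
    exact H (q.natDegree + 1) q
      (degree_le_natDegree.trans_lt (by exact_mod_cast Nat.lt_succ_self _))
  intro N
  induction N with
  | zero =>
    intro q hq
    have : q = 0 := by simpa using hq
    simp [this]
  | succ N ih =>
    intro q hq
    have h1 := ih _ (hP.degree_sub_lt hq)
    rw [map_sub, map_sub, map_C_mul, map_C_mul, h] at h1
    linear_combination h1

/-- The Fourier sum of `v` in the basis `P_j` is finite under the hypothesis, and it has the right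
value on each `P_n`. -/
lemma exists_eq_leftMul (hP : IsMonicOPS u P) {v : Module.Dual ℂ ℂ[X]} {N : ℕ}
    (h : ∀ n, N ≤ n → v (P n) = 0) : ∃ f : ℂ[X], f.degree < N ∧ v = leftMul f u := by
  refine ⟨∑ j ∈ Finset.range N, C (v (P j) / u (P j * P j)) * P j, ?_, hP.dual_ext fun n => ?_⟩
  · rw [degree_lt_iff_coeff_zero]
    intro m hm
    rw [finsetSum_coeff]
    refine Finset.sum_eq_zero fun j hj => ?_
    rw [coeff_C_mul, hP.coeff_of_lt ((Finset.mem_range.1 hj).trans_le hm), mul_zero]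
  · rw [leftMul_apply, Finset.sum_mul, map_sum]
    simp_rw [mul_assoc, map_C_mul]
    by_cases hn : n < N
    · rw [Finset.sum_eq_single_of_mem n (Finset.mem_range.2 hn)
        fun j _ hj => by rw [hP.apply_mul_of_ne hj, mul_zero]]
      rw [div_mul_cancel₀ _ (hP.norm_ne_zero n)]
    · rw [h n (by omega)]
      refine (Finset.sum_eq_zero fun j hj => ?_).symm
      rw [hP.apply_mul_of_ne (m := j) (n := n) (by have := Finset.mem_range.1 hj; omega), mul_zero]

end IsMonicOPS

/-! ### The three-term recurrence -/

/-- The coefficients `β_n` of the three-term recurrence relation. -/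
noncomputable def recBeta (u : Module.Dual ℂ ℂ[X]) (P : ℕ → ℂ[X]) (n : ℕ) : ℂ :=
  u (X * P n * P n) / u (P n * P n)

/-- The coefficients `γ_n` of the three-term recurrence relation. -/
noncomputable def recGamma (u : Module.Dual ℂ ℂ[X]) (P : ℕ → ℂ[X]) (n : ℕ) : ℂ :=
  u (P n * P n) / u (P (n - 1) * P (n - 1))

namespace IsMonicOPS

/-- This includes `n = 0`: truncated subtraction makes that value 1, and it is harmless because
`prev P 0 = 0`. -/
lemma recGamma_ne_zero (hP : IsMonicOPS u P) (n : ℕ) : recGamma u P n ≠ 0 :=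
  div_ne_zero (hP.norm_ne_zero _) (hP.norm_ne_zero _)

lemma norm_succ (hP : IsMonicOPS u P) (n : ℕ) :
    u (P (n + 1) * P (n + 1)) = recGamma u P (n + 1) * u (P n * P n) :=
  (div_mul_cancel₀ _ (hP.norm_ne_zero n)).symm

lemma apply_X_mul_mul (hP : IsMonicOPS u P) (n : ℕ) :
    u (X * P n * P n) = recBeta u P n * u (P n * P n) :=
  (div_mul_cancel₀ _ (hP.norm_ne_zero n)).symm

lemma apply_X_mul_succ (hP : IsMonicOPS u P) (n : ℕ) :
    u (X * P n * P (n + 1)) = u (P (n + 1) * P (n + 1)) := by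
  rw [hP.apply_mul, coeff_X_mul, hP.coeff_self, one_mul]
  rw [degree_mul, degree_X, hP.degree_eq]
  exact_mod_cast (by omega : 1 + n < n + 1 + 1)

lemma apply_X_mul_of_lt (hP : IsMonicOPS u P) {n m : ℕ} (h : n + 1 < m) :
    u (X * P n * P m) = 0 := by
  rw [hP.apply_mul_of_degree_lt]
  rw [degree_mul, degree_X, hP.degree_eq]
  exact_mod_cast (by omega : 1 + n < m)

lemma ttrr (hP : IsMonicOPS u P) : TTRR P (recBeta u P) (recGamma u P) := by
  refine ⟨hP.zero_eq, fun n => ?_⟩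
  rw [eq_comm, ← sub_eq_zero]
  refine hP.eq_zero_of_forall fun j => ?_
  have key : u (((X - C (recBeta u P n)) * P n - C (recGamma u P n) * prev P n - P (n + 1)) * P j)
      = u (X * P n * P j) - recBeta u P n * u (P n * P j)
        - recGamma u P n * u (prev P n * P j) - u (P (n + 1) * P j) := by
    rw [← map_C_mul, ← map_C_mul, ← map_sub, ← map_sub, ← map_sub]
    congr 1
    ring
  rw [key]
  have hprev : ∀ j, j + 1 ≠ n → u (prev P n * P j) = 0 := by
    intro j hj
    cases n with
    | zero => simp [prev]
    | succ n => exact hP.apply_mul_of_ne (by omega)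
  rcases lt_trichotomy j n with h | rfl | h
  · obtain ⟨n, rfl⟩ : ∃ k, n = k + 1 := ⟨n - 1, by omega⟩
    rw [hP.apply_mul_of_ne (m := n + 1) (by omega), hP.apply_mul_of_ne (m := n + 1 + 1) (by omega),
      mul_right_comm]
    rcases (Nat.lt_succ_iff.1 h).eq_or_lt with rfl | h
    · rw [hP.apply_X_mul_succ, hP.norm_succ, prev]
      ring
    · rw [hP.apply_X_mul_of_lt (by omega), hprev _ (by omega)]
      ring
  · rw [hP.apply_X_mul_mul, hprev _ (by omega), hP.apply_mul_of_ne (m := j + 1) (by omega)]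
    ring
  · rw [hprev _ (by omega), hP.apply_mul_of_ne (m := n) (by omega)]
    rcases (Nat.succ_le_of_lt h).eq_or_lt with rfl | h
    · rw [hP.apply_X_mul_succ]
      ring
    · rw [hP.apply_X_mul_of_lt (by omega), hP.apply_mul_of_ne (by omega)]
      ring

end IsMonicOPS

/-! ### The operator `φ q'' + ψ q'`: eigenpolynomials, admissibility, Bochner's equation -/

lemma eq_quadratic (hφ : φ.natDegree ≤ 2) :
    φ = C (φ.coeff 2) * X ^ 2 + C (φ.coeff 1) * X + C (φ.coeff 0) := by
  have h := φ.as_sum_range' 3 (by omega)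
  simp only [Finset.sum_range_succ, Finset.sum_range_zero, ← C_mul_X_pow_eq_monomial] at h
  conv_lhs => rw [h]
  ring

lemma coeff_bochner (hφ : φ.natDegree ≤ 2) (hψ : ψ.natDegree ≤ 1) (q : ℂ[X]) (n : ℕ) :
    (φ * derivative (derivative q) + ψ * derivative q).coeff n =
      n * dCoef φ ψ (n - 1) * q.coeff n + (n + 1) * eCoef φ ψ n * q.coeff (n + 1)
        + (n + 2) * (n + 1) * φ.coeff 0 * q.coeff (n + 2) := by
  rw [eq_X_add_C_of_natDegree_le_one hψ, eq_quadratic hφ]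
  generalize φ.coeff 2 = a
  generalize φ.coeff 1 = b
  generalize φ.coeff 0 = c
  generalize ψ.coeff 1 = p
  generalize ψ.coeff 0 = q'
  rcases n with _ | _ | n <;>
  · simp [dCoef, eCoef, add_mul, mul_assoc, coeff_X_pow_mul', coeff_derivative, coeff_X, coeff_C]
    ring

lemma bochner_symm (h : Pearson u φ ψ) (p q : ℂ[X]) :
    u ((φ * derivative (derivative p) + ψ * derivative p) * q) =
      -u (φ * derivative p * derivative q) := by
  have := pearson_iff.1 h (derivative p * q)
  rw [derivative_mul] at this
  rw [eq_neg_iff_add_eq_zero, ← map_add, ← this]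
  congr 1
  ring

lemma bochner_mul_comm (h : Pearson u φ ψ) (p q : ℂ[X]) :
    u ((φ * derivative (derivative p) + ψ * derivative p) * q) =
      u ((φ * derivative (derivative q) + ψ * derivative q) * p) := by
  rw [bochner_symm h, bochner_symm h, mul_right_comm]

lemma degree_bochner_lt (hφ : φ.natDegree ≤ 2) (hψ : ψ.natDegree ≤ 1) {q : ℂ[X]} {n : ℕ}
    (hq : q.degree < n) : (φ * derivative (derivative q) + ψ * derivative q).degree < n := by
  rw [degree_lt_iff_coeff_zero] at hq ⊢
  intro m hm
  rw [coeff_bochner hφ hψ, hq m hm, hq (m + 1) (by omega), hq (m + 2) (by omega)]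
  ring

/-- The difference of the two sides has degree below `n`, so it is orthogonal to `P_j` for `j ≥ n`;
for `j < n`, symmetry moves the operator onto `P_j`, whose image still has degree below `n`. -/
lemma bochner_eq (hP : IsMonicOPS u P) (hφ : φ.natDegree ≤ 2) (hψ : ψ.natDegree ≤ 1)
    (h : Pearson u φ ψ) (n : ℕ) :
    φ * derivative (derivative (P n)) + ψ * derivative (P n) =
      C (n * dCoef φ ψ (n - 1)) * P n := by
  rw [← sub_eq_zero]
  have hlt : (P n).degree < (n + 1 : ℕ) := by
    rw [hP.degree_eq]; exact_mod_cast Nat.lt_succ_self n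
  have hdeg := hP.degree_sub_lt (degree_bochner_lt hφ hψ hlt)
  have hc : (φ * derivative (derivative (P n)) + ψ * derivative (P n)).coeff n =
      n * dCoef φ ψ (n - 1) := by
    rw [coeff_bochner hφ hψ, hP.coeff_self, hP.coeff_of_lt (by omega), hP.coeff_of_lt (by omega)]
    ring
  rw [hc] at hdeg
  refine hP.eq_zero_of_forall fun j => ?_
  rcases lt_or_ge j n with hj | hj
  · rw [sub_mul, map_sub, bochner_mul_comm h, mul_assoc, map_C_mul, hP.apply_mul_of_ne hj.ne',
      hP.apply_mul_of_degree_lt]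
    · ring
    · refine degree_bochner_lt hφ hψ ?_
      rw [hP.degree_eq]; exact_mod_cast hj
  · exact hP.apply_mul_of_degree_lt (hdeg.trans_le (by exact_mod_cast hj))

lemma IsMonicOPS.derivative_ne_zero (hP : IsMonicOPS u P) {n : ℕ} (hn : 1 ≤ n) :
    derivative (P n) ≠ 0 := by
  intro h
  have := derivative_eq_zero.1 h
  rw [hP.natDegree_eq] at this
  omega

/-- Every polynomial is a derivative. -/
lemma derivative_surjective : Function.Surjective (derivative (R := ℂ)) := by
  intro p
  induction p using Polynomial.induction_on' with
  | add p q hp hq =>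
    obtain ⟨p', rfl⟩ := hp
    obtain ⟨q', rfl⟩ := hq
    exact ⟨p' + q', map_add _ _ _⟩
  | monomial n a =>
    refine ⟨monomial (n + 1) (a / (n + 1)), ?_⟩
    rw [derivative_monomial]
    push_cast
    rw [div_mul_cancel₀ _ (by exact_mod_cast Nat.succ_ne_zero n)]

lemma eq_zero_of_apply_mul_derivative (hP : IsMonicOPS u P) {f : ℂ[X]}
    (h : ∀ q, u (f * derivative q) = 0) : f = 0 := by
  refine hP.eq_zero_of_forall fun j => ?_
  obtain ⟨q, hq⟩ := derivative_surjective (P j)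
  rw [← hq, h]

/-- If `d_n = 0`, the eigenvalue of `P_{n+1}` is zero, and symmetry makes `φ P_{n+1}'` orthogonal to
all derivatives, that is, to everything. -/
lemma admissible_of_pearson (hP : IsMonicOPS u P) (hφ0 : φ ≠ 0) (hφ : φ.natDegree ≤ 2)
    (hψ : ψ.natDegree ≤ 1) (h : Pearson u φ ψ) : Admissible φ ψ := by
  refine ⟨hφ, hψ, fun n hn => ?_⟩
  have h1 := bochner_eq hP hφ hψ h (n + 1)
  have h2 : φ * derivative (P (n + 1)) = 0 := by
    refine eq_zero_of_apply_mul_derivative hP fun q => ?_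
    have h3 := bochner_symm h (P (n + 1)) q
    rw [h1] at h3
    have : ((n + 1 : ℕ) : ℤ) - 1 = n := by push_cast; ring
    rw [this, hn] at h3
    simpa using h3.symm
  exact (mul_ne_zero hφ0 (hP.derivative_ne_zero (by omega))) h2

lemma Pearson.psi_ne_zero (hP : IsMonicOPS u P) (hφ0 : φ ≠ 0) (h : Pearson u φ ψ) : ψ ≠ 0 := by
  rintro rfl
  refine hφ0 (eq_zero_of_apply_mul_derivative hP fun q => ?_)
  simpa using pearson_iff.1 h q

lemma c1At_iff_c1At' (hP : IsMonicOPS u P) : C1At u φ ψ ↔ C1At' u φ ψ := by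
  constructor
  · rintro ⟨hφ0, hφ, -, hψ, h⟩
    exact ⟨admissible_of_pearson hP hφ0 hφ hψ h, h⟩
  · rintro ⟨⟨hφ, hψ, hd⟩, h⟩
    have hψ0 : ψ ≠ 0 := by
      rintro rfl
      simpa [dCoef] using hd 0
    refine ⟨?_, hφ, hψ0, hψ, h⟩
    rintro rfl
    refine hψ0 (hP.eq_zero_of_forall fun j => ?_)
    simpa using pearson_iff.1 h (P j)

lemma bochnerEq_iff (hP : IsMonicOPS u P) (h : C1At u φ ψ) (n : ℕ) (l : ℂ) :
    BochnerEq P φ ψ n l ↔ l = -(n * dCoef φ ψ (n - 1)) := by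
  obtain ⟨-, hφ, -, hψ, h⟩ := h
  rw [BochnerEq, bochner_eq hP hφ hψ h, ← add_mul, ← C_add, mul_eq_zero, C_eq_zero,
    or_iff_left (hP.ne_zero n), eq_neg_iff_add_eq_zero, add_comm]

lemma c5At_of_c1At (hP : IsMonicOPS u P) (h : C1At u φ ψ) : C5At P φ ψ := by
  refine ⟨fun n => -(n * dCoef φ ψ (n - 1)), fun n hn => ?_, fun n =>
    (bochnerEq_iff hP h n _).2 rfl⟩
  obtain ⟨n, rfl⟩ : ∃ k, n = k + 1 := ⟨n - 1, by omega⟩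
  refine neg_ne_zero.2 (mul_ne_zero (by exact_mod_cast Nat.succ_ne_zero n) ?_)
  have := ((c1At_iff_c1At' hP).1 h).1.2.2 n
  rwa [show ((n + 1 : ℕ) : ℤ) - 1 = n by push_cast; ring]

lemma derivative_P_one (hP : IsMonicOPS u P) : derivative (P 1) = 1 := by
  rw [eq_X_add_C_of_natDegree_le_one (hP.natDegree_eq 1).le, hP.coeff_self]
  simp

/-- No degree bound is assumed. The equation at `n = 1` forces `ψ = -λ_1 P_1`, and at `n = 2`, where
`P_2'' = 2`, it bounds the degree of `φ`. Applying `u` to all the equations gives Pearson's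
equation, tested on derivatives. -/
lemma c1At_of_c5At (hP : IsMonicOPS u P) (h : C5At P φ ψ) : C1At u φ ψ := by
  obtain ⟨l, hl0, hl⟩ := h
  have hψ : ψ = C (-l 1) * P 1 := by
    have := hl 1
    rw [BochnerEq, derivative_P_one hP, derivative_one] at this
    rw [C_neg]
    linear_combination this
  have hψ1 : ψ.natDegree ≤ 1 := by
    rw [hψ]
    exact (natDegree_C_mul_le _ _).trans (hP.natDegree_eq 1).le
  have hψ0 : ψ ≠ 0 := by
    rw [hψ]
    exact mul_ne_zero (C_ne_zero.2 (neg_ne_zero.2 (hl0 1 le_rfl))) (hP.ne_zero 1)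
  have hpear : Pearson u φ ψ := by
    rw [pearson_iff]
    intro q
    obtain ⟨p, rfl⟩ := derivative_surjective q
    have : u ∘ₗ (LinearMap.mulLeft ℂ φ ∘ₗ derivative ∘ₗ derivative
        + LinearMap.mulLeft ℂ ψ ∘ₗ derivative) = 0 := by
      refine hP.dual_ext fun n => ?_
      have h2 : φ * derivative (derivative (P n)) + ψ * derivative (P n) = C (-l n) * P n := by
        have := hl n
        rw [BochnerEq] at this
        rw [C_neg]
        linear_combination this
      simp only [LinearMap.comp_apply, LinearMap.add_apply, LinearMap.mulLeft_apply,
        LinearMap.zero_apply]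
      rw [h2, map_C_mul]
      rcases n with _ | n
      · have := hl 0
        rw [BochnerEq, hP.zero_eq] at this
        have h0 : l 0 = 0 := by simpa using this
        simp [h0]
      · rw [hP.apply_eq_zero (by omega), mul_zero]
    exact LinearMap.congr_fun this p
  have hP2 : (P 2).natDegree ≤ 2 := (hP.natDegree_eq 2).le
  have hd2 : derivative (derivative (P 2)) = C 2 := by
    rw [eq_quadratic hP2, hP.coeff_self]
    simp
    rw [one_add_one_eq_two]
    exact (map_ofNat C 2).symm
  have hd1 : (derivative (P 2)).natDegree ≤ 1 := by
    refine (natDegree_derivative_le _).trans ?_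
    omega
  refine ⟨?_, ?_, hψ0, hψ1, hpear⟩
  · rintro rfl
    refine hψ0 (hP.eq_zero_of_forall fun j => ?_)
    simpa using pearson_iff.1 hpear (P j)
  · have h2 := hl 2
    rw [BochnerEq, hd2] at h2
    have : φ = C (-1 / 2) * (ψ * derivative (P 2) + C (l 2) * P 2) := by
      have hC : (C (-1 / 2) * C 2 : ℂ[X]) = -1 := by
        rw [← C_mul]; norm_num
      linear_combination φ * hC - C (-1 / 2) * h2
    rw [this]
    refine (natDegree_C_mul_le _ _).trans (natDegree_add_le_of_degree_le ?_ ?_)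
    · exact natDegree_mul_le.trans (by omega)
    · exact (natDegree_C_mul_le _ _).trans hP2

/-! ### Higher derivatives and the Rodrigues formula -/

lemma iterate_derivative_bochner {y : ℂ[X]} {μ : ℂ} (hφ : φ.natDegree ≤ 2) (hψ : ψ.natDegree ≤ 1)
    (h : φ * derivative (derivative y) + ψ * derivative y = C μ * y) (k : ℕ) :
    φ * derivative^[k + 2] y + (ψ + k * derivative φ) * derivative^[k + 1] y =
      C (μ - k * dCoef φ ψ (k - 1)) * derivative^[k] y := by
  induction k with
  | zero => simpa using h
  | succ k ih =>
    have ih' := congrArg derivative ih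
    simp only [derivative_mul, derivative_add, derivative_C, derivative_natCast,
      ← Function.iterate_succ_apply' (f := derivative)] at ih'
    have h2 : derivative (derivative φ) = C (2 * φ.coeff 2) := by
      conv_lhs => rw [eq_quadratic hφ]
      simp
      rw [one_add_one_eq_two, mul_comm, map_ofNat]
    have h1 : derivative ψ = C (ψ.coeff 1) := by
      conv_lhs => rw [eq_X_add_C_of_natDegree_le_one hψ]
      simp
    rw [h2, h1] at ih'
    have e1 : (C (μ - k * dCoef φ ψ (k - 1)) : ℂ[X]) =
        C (μ - (k + 1 : ℕ) * dCoef φ ψ ((k + 1 : ℕ) - 1)) + C (ψ.coeff 1)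
          + k * C (2 * φ.coeff 2) := by
      rw [← C_eq_natCast, ← C_mul, ← C_add, ← C_add]
      congr 1
      simp only [dCoef]
      push_cast
      ring
    rw [e1] at ih'
    push_cast at ih' ⊢
    linear_combination ih'

lemma iterate_derivative_P (hP : IsMonicOPS u P) (h : C1At u φ ψ) (m k : ℕ) :
    φ * derivative^[k + 2] (P m) + (ψ + k * derivative φ) * derivative^[k + 1] (P m) =
      C ((m - k) * dCoef φ ψ (m + k - 1)) * derivative^[k] (P m) := by
  obtain ⟨-, hφ, -, hψ, h⟩ := h
  rw [iterate_derivative_bochner hφ hψ (bochner_eq hP hφ hψ h m)]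
  congr 2
  simp only [dCoef]
  push_cast
  ring

/-- Integration by parts: Pearson's equation is tested with `φ^k P_m^{(k+1)} q`, and the resulting
second-order expression is collapsed by the equation for `P_m^{(k)}`. The eigenvalue comes from `m
d_{m-1} - k d_{k-1} = (m-k) d_{m+k-1}`. -/
lemma apply_pow_succ_mul (hP : IsMonicOPS u P) (h : C1At u φ ψ) (m k : ℕ) (q : ℂ[X]) :
    u (φ ^ (k + 1) * derivative^[k + 1] (P m) * derivative q) =
      -((m - k) * dCoef φ ψ (m + k - 1)) * u (φ ^ k * derivative^[k] (P m) * q) := by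
  have h1 := iterate_derivative_P hP h m k
  have h2 := pearson_iff.1 h.2.2.2.2 (φ ^ k * derivative^[k + 1] (P m) * q)
  simp only [derivative_mul, ← Function.iterate_succ_apply' (f := derivative)] at h2
  rw [← map_C_mul, ← sub_eq_zero, ← map_sub, ← h2]
  congr 1
  rw [C_neg, neg_mul]
  have h3 : φ * derivative (φ ^ k) = k * derivative φ * φ ^ k := by
    rcases k with _ | k
    · simp
    · rw [derivative_pow]
      simp
      ring
  linear_combination -(φ ^ k * q) * h1 - derivative^[k + 1] (P m) * q * h3

lemma dCoef_ne_zero (hP : IsMonicOPS u P) (h : C1At u φ ψ) {k : ℤ} (hk : 0 ≤ k) :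
    dCoef φ ψ k ≠ 0 := by
  obtain ⟨n, rfl⟩ := Int.eq_ofNat_of_zero_le hk
  exact ((c1At_iff_c1At' hP).1 h).1.2.2 n

lemma apply_iterate_derivative_of_ne (hP : IsMonicOPS u P) (h : C1At u φ ψ) (k : ℕ) {m n : ℕ}
    (hmn : m ≠ n) : u (φ ^ k * derivative^[k] (P m) * derivative^[k] (P n)) = 0 := by
  induction k with
  | zero => simpa using hP.apply_mul_of_ne hmn
  | succ k ih =>
    rw [Function.iterate_succ_apply' (f := derivative) (n := k) (x := P n),
      apply_pow_succ_mul hP h, ih, mul_zero]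

lemma apply_iterate_derivative_self (hP : IsMonicOPS u P) (h : C1At u φ ψ) (k : ℕ) {m : ℕ}
    (hm : k ≤ m) : u (φ ^ k * derivative^[k] (P m) * derivative^[k] (P m)) ≠ 0 := by
  induction k with
  | zero => simpa using hP.norm_ne_zero m
  | succ k ih =>
    have h1 := apply_pow_succ_mul hP h m k (derivative^[k] (P m))
    rw [← Function.iterate_succ_apply' (f := derivative)] at h1
    rw [h1]
    refine mul_ne_zero (neg_ne_zero.2 (mul_ne_zero ?_ (dCoef_ne_zero hP h (by omega))))
      (ih (by omega))
    exact sub_ne_zero.2 (by exact_mod_cast (by omega : m ≠ k))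

lemma normDeriv_zero (P : ℕ → ℂ[X]) (n : ℕ) : normDeriv P 0 n = P n := by
  simp [normDeriv]

lemma ascFactorial_cast_ne_zero (n k : ℕ) : (((n + 1).ascFactorial k : ℕ) : ℂ) ≠ 0 :=
  Nat.cast_ne_zero.2 (Nat.ascFactorial_pos _ _).ne'

lemma iterate_derivative_eq (P : ℕ → ℂ[X]) (k n : ℕ) :
    derivative^[k] (P (n + k)) = C (((n + 1).ascFactorial k : ℕ) : ℂ) * normDeriv P k n := by
  rw [normDeriv, smul_eq_C_mul, ← mul_assoc, ← C_mul,
    mul_inv_cancel₀ (ascFactorial_cast_ne_zero n k), C_1, one_mul]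

lemma normDeriv_coeff (hP : IsMonicOPS u P) (k n m : ℕ) (hm : n ≤ m) :
    (normDeriv P k n).coeff m = if m = n then 1 else 0 := by
  rw [normDeriv, coeff_smul, coeff_iterate_derivative]
  split_ifs with h
  · subst h
    rw [hP.coeff_self, Nat.add_descFactorial_eq_ascFactorial, nsmul_eq_mul, mul_one, smul_eq_mul,
      inv_mul_cancel₀ (ascFactorial_cast_ne_zero m k)]
  · rw [hP.coeff_of_lt (by omega)]
    simp

lemma normDeriv_degree (hP : IsMonicOPS u P) (k n : ℕ) : (normDeriv P k n).degree = n := by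
  refine le_antisymm (degree_le_iff_coeff_zero _ _ |>.2 fun m hm => ?_)
    (le_degree_of_ne_zero ?_)
  · have hm : n < m := by exact_mod_cast hm
    rw [normDeriv_coeff hP k n m hm.le, if_neg hm.ne']
  · rw [normDeriv_coeff hP k n n le_rfl, if_pos rfl]
    exact one_ne_zero

lemma normDeriv_monic (hP : IsMonicOPS u P) (k n : ℕ) : (normDeriv P k n).Monic := by
  rw [Monic, leadingCoeff, natDegree_eq_of_degree_eq_some (normDeriv_degree hP k n),
    normDeriv_coeff hP k n n le_rfl, if_pos rfl]

lemma isMonicOPS_normDeriv (hP : IsMonicOPS u P) (h : C1At u φ ψ) (k : ℕ) :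
    IsMonicOPS (leftMul (φ ^ k) u) (normDeriv P k) := by
  refine ⟨⟨normDeriv_degree hP k,
    fun n => u (φ ^ k * (normDeriv P k n * normDeriv P k n)), fun n hn => ?_, fun m n => ?_⟩,
    normDeriv_monic hP k⟩
  · replace hn : u (φ ^ k * (normDeriv P k n * normDeriv P k n)) = 0 := hn
    refine apply_iterate_derivative_self hP h k (m := n + k) (by omega) ?_
    rw [iterate_derivative_eq, mul_assoc, mul_mul_mul_comm, ← C_mul, mul_left_comm, map_C_mul, hn,
      mul_zero]
  · split_ifs with hmn
    · rw [hmn, leftMul_apply]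
    · have := apply_iterate_derivative_of_ne hP h k (m := m + k) (n := n + k) (by omega)
      rw [iterate_derivative_eq, iterate_derivative_eq, mul_assoc, mul_mul_mul_comm, ← C_mul,
        mul_left_comm, map_C_mul] at this
      rw [leftMul_apply]
      exact (mul_eq_zero.1 this).resolve_left
        (mul_ne_zero (ascFactorial_cast_ne_zero m k) (ascFactorial_cast_ne_zero n k))

lemma c3At_of_c1At (hP : IsMonicOPS u P) (h : C1At u φ ψ) (k : ℕ) : C3At P k :=
  ⟨_, isMonicOPS_normDeriv hP h k⟩

lemma distDeriv_smul (c : ℂ) (v : Module.Dual ℂ ℂ[X]) : distDeriv (c • v) = c • distDeriv v := by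
  refine LinearMap.ext fun q => ?_
  simp

/-- The formula is climbed from the constant `P_n^{(n)} = n!`, which accounts for the factorial.
Each application of `D` is `apply_pow_succ_mul` with `m = n` and `k = n - j - 1`, and removes one
derivative and one factor `φ`. -/
lemma iterate_distDeriv (hP : IsMonicOPS u P) (h : C1At u φ ψ) (n j : ℕ) (hj : j ≤ n) :
    (n.factorial : ℂ) • distDeriv^[j] (leftMul (φ ^ n) u) =
      ((∏ i ∈ Finset.range j, (i + 1) * dCoef φ ψ (2 * n - 2 - i)) : ℂ) •
        leftMul (φ ^ (n - j) * derivative^[n - j] (P n)) u := by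
  induction j with
  | zero =>
    have : derivative^[n] (P n) = C (n.factorial : ℂ) := by
      have h1 := iterate_derivative_eq P n 0
      rw [zero_add, zero_add, Nat.one_ascFactorial] at h1
      rw [h1, (normDeriv_monic hP n 0).natDegree_eq_zero.1
        (natDegree_eq_of_degree_eq_some (normDeriv_degree hP n 0)), mul_one]
    refine LinearMap.ext fun q => ?_
    simp only [Nat.sub_zero, Function.iterate_zero, id, this, LinearMap.smul_apply, leftMul_apply,
      Finset.range_zero, Finset.prod_empty, smul_eq_mul, one_mul]
    rw [← map_C_mul]
    congr 1
    ring
  | succ j ih =>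
    rw [Function.iterate_succ_apply', ← distDeriv_smul, ih (by omega), Finset.prod_range_succ,
      mul_smul, distDeriv_smul]
    congr 1
    refine LinearMap.ext fun q => ?_
    obtain ⟨k, rfl⟩ : ∃ k, n = k + 1 + j := ⟨n - 1 - j, by omega⟩
    rw [distDeriv_apply, leftMul_apply, show k + 1 + j - j = k + 1 by omega,
      show k + 1 + j - (j + 1) = k by omega, apply_pow_succ_mul hP h, LinearMap.smul_apply,
      leftMul_apply, smul_eq_mul, neg_mul, neg_neg]
    congr 1
    simp only [dCoef]
    push_cast
    ring

lemma iterate_distDeriv_self (hP : IsMonicOPS u P) (h : C1At u φ ψ) (n : ℕ) :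
    distDeriv^[n] (leftMul (φ ^ n) u) =
      (∏ i ∈ Finset.range n, dCoef φ ψ (n + i - 1)) • leftMul (P n) u := by
  have h1 := iterate_distDeriv hP h n n le_rfl
  have h2 : (∏ i ∈ Finset.range n, ((i : ℂ) + 1)) = n.factorial := by
    rw [← Finset.prod_range_add_one_eq_factorial]
    push_cast
    rfl
  have h3 : (∏ i ∈ Finset.range n, dCoef φ ψ (2 * n - 2 - i)) =
      ∏ i ∈ Finset.range n, dCoef φ ψ (n + i - 1) := by
    rw [← Finset.prod_range_reflect]
    refine Finset.prod_congr rfl fun i hi => ?_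
    have := Finset.mem_range.1 hi
    congr 1
    omega
  rw [Finset.prod_mul_distrib, h2, h3, mul_smul, Nat.sub_self, pow_zero, one_mul,
    Function.iterate_zero, id] at h1
  exact smul_right_injective _ (Nat.cast_ne_zero.2 n.factorial_ne_zero) h1

lemma rodriguesEq_iff (hP : IsMonicOPS u P) (h : C1At u φ ψ) (n : ℕ) (κ : ℂ) :
    RodriguesEq u P φ n κ ↔ κ = ∏ i ∈ Finset.range n, (dCoef φ ψ (n + i - 1))⁻¹ := by
  have hd : ∏ i ∈ Finset.range n, dCoef φ ψ (n + i - 1) ≠ 0 :=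
    Finset.prod_ne_zero_iff.2 fun i hi =>
      dCoef_ne_zero hP h (by have := Finset.mem_range.1 hi; omega)
  have hne : leftMul (P n) u ≠ 0 := fun h0 =>
    hP.ne_zero n (hP.leftMul_injective (h0.trans (by ext; simp)))
  rw [RodriguesEq, iterate_distDeriv_self hP h, smul_smul, Finset.prod_inv_distrib,
    ← mul_eq_one_iff_eq_inv₀ hd]
  constructor
  · intro h1
    refine smul_left_injective ℂ hne ?_
    simpa using h1.symm
  · intro h1
    rw [h1, one_smul]

lemma c8At_of_c1At (hP : IsMonicOPS u P) (h : C1At u φ ψ) : C8At u P φ := by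
  refine ⟨h.2.1, fun n => ∏ i ∈ Finset.range n, (dCoef φ ψ (n + i - 1))⁻¹, fun n => ?_, fun n =>
    (rodriguesEq_iff hP h n _).2 rfl⟩
  exact Finset.prod_ne_zero_iff.2 fun i hi =>
    inv_ne_zero (dCoef_ne_zero hP h (by have := Finset.mem_range.1 hi; omega))

lemma c1At_of_c8At (hP : IsMonicOPS u P) (h : C8At u P φ) : ∃ ψ, C1At u φ ψ := by
  obtain ⟨hφ, κ, hκ0, hκ⟩ := h
  have h1 := hκ 1
  simp only [RodriguesEq, pow_one, Function.iterate_one] at h1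
  have hpear : Pearson u φ (C (κ 1)⁻¹ * P 1) := by
    rw [Pearson]
    refine LinearMap.ext fun q => ?_
    have h2 := LinearMap.congr_fun h1 q
    rw [leftMul_apply, LinearMap.smul_apply, smul_eq_mul] at h2
    rw [leftMul_apply, mul_assoc, map_C_mul, h2, inv_mul_cancel_left₀ (hκ0 1)]
  have hφ0 : φ ≠ 0 := by
    rintro rfl
    refine hP.ne_zero 1 (hP.leftMul_injective (g := 0) ?_)
    rw [h1]
    refine LinearMap.ext fun q => ?_
    simp
  refine ⟨_, hφ0, hφ, hpear.psi_ne_zero hP hφ0, ?_, hpear⟩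
  exact (natDegree_C_mul_le _ _).trans (hP.natDegree_eq 1).le

/-! ### Explicit recurrence coefficients -/

section Recurrence

lemma coeff_bochner_P (hP : IsMonicOPS u P) (h : C1At u φ ψ) (m n : ℕ) :
    n * dCoef φ ψ (n - 1) * (P m).coeff n + (n + 1) * eCoef φ ψ n * (P m).coeff (n + 1)
        + (n + 2) * (n + 1) * φ.coeff 0 * (P m).coeff (n + 2) =
      m * dCoef φ ψ (m - 1) * (P m).coeff n := by
  obtain ⟨-, hφ, -, hψ, h⟩ := h
  rw [← coeff_bochner hφ hψ, bochner_eq hP hφ hψ h, coeff_C_mul]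

/-- The denominator is the eigenvalue gap `(n+1) d_n - n d_{n-1} = d_{2n}`. For the next coefficient
the gap is `(n+2) d_{n+1} - n d_{n-1} = 2 d_{2n+1}`. -/
lemma coeff_succ_self (hP : IsMonicOPS u P) (h : C1At u φ ψ) (n : ℕ) :
    (P (n + 1)).coeff n = (n + 1) * eCoef φ ψ n / dCoef φ ψ (2 * n) := by
  have h1 := coeff_bochner_P hP h (n + 1) n
  rw [hP.coeff_self, hP.coeff_of_lt (n := n + 1) (m := n + 2) (by omega)] at h1
  rw [eq_div_iff (dCoef_ne_zero hP h (by omega))]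
  simp only [dCoef] at h1 ⊢
  push_cast at h1 ⊢
  linear_combination -h1

lemma coeff_add_two_self (hP : IsMonicOPS u P) (h : C1At u φ ψ) (n : ℕ) :
    (P (n + 2)).coeff n = (n + 1) * ((n + 2) * eCoef φ ψ n * eCoef φ ψ (n + 1) / dCoef φ ψ (2 * n + 2)
      + (n + 2) * φ.coeff 0) / (2 * dCoef φ ψ (2 * n + 1)) := by
  have h1 := coeff_bochner_P hP h (n + 2) n
  have h2 := coeff_succ_self hP h (n + 1)
  rw [hP.coeff_self] at h1
  rw [eq_div_iff (mul_ne_zero two_ne_zero (dCoef_ne_zero hP h (by omega)))]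
  have h3 : (n + 2) * eCoef φ ψ n * eCoef φ ψ (n + 1) / dCoef φ ψ (2 * n + 2) =
      eCoef φ ψ n * (P (n + 2)).coeff (n + 1) := by
    rw [h2]
    push_cast
    rw [show (2 * ((n : ℤ) + 1)) = 2 * n + 2 by ring]
    ring
  rw [h3]
  simp only [dCoef] at h1 ⊢
  push_cast at h1 ⊢
  linear_combination -h1

lemma recBeta_zero (hP : IsMonicOPS u P) : recBeta u P 0 = -(P 1).coeff 0 := by
  have h1 := congrArg (fun p => coeff p 0) (hP.ttrr.2 0)
  simp only [prev, hP.zero_eq] at h1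
  simp [h1]

lemma recBeta_succ (hP : IsMonicOPS u P) (n : ℕ) :
    recBeta u P (n + 1) = (P (n + 1)).coeff n - (P (n + 2)).coeff (n + 1) := by
  have h1 := congrArg (fun p => coeff p (n + 1)) (hP.ttrr.2 (n + 1))
  simp only [prev, sub_mul, coeff_sub, coeff_X_mul, coeff_C_mul, hP.coeff_self,
    hP.coeff_of_lt (Nat.lt_succ_self n)] at h1
  linear_combination h1

lemma recGamma_one (hP : IsMonicOPS u P) :
    recGamma u P 1 = -recBeta u P 1 * (P 1).coeff 0 - (P 2).coeff 0 := by
  have h1 := congrArg (fun p => coeff p 0) (hP.ttrr.2 1)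
  simp only [prev, sub_mul, coeff_sub, mul_coeff_zero, coeff_X_zero, coeff_C_zero,
    hP.coeff_self 0] at h1
  linear_combination h1

lemma recGamma_add_two (hP : IsMonicOPS u P) (n : ℕ) :
    recGamma u P (n + 2) = (P (n + 2)).coeff n
      - recBeta u P (n + 2) * (P (n + 2)).coeff (n + 1) - (P (n + 3)).coeff (n + 1) := by
  have h1 := congrArg (fun p => coeff p (n + 1)) (hP.ttrr.2 (n + 2))
  simp only [prev, sub_mul, coeff_sub, coeff_X_mul, coeff_C_mul, hP.coeff_self] at h1
  linear_combination h1

lemma recBeta_zero_eq (hP : IsMonicOPS u P) (h : C1At u φ ψ) :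
    recBeta u P 0 = -(eCoef φ ψ 0 / dCoef φ ψ 0) := by
  have := coeff_succ_self hP h 0
  rw [recBeta_zero hP, this]
  simp

lemma recBeta_eq (hP : IsMonicOPS u P) (h : C1At u φ ψ) {n : ℕ} (hn : 1 ≤ n) :
    recBeta u P n = -((dCoef φ ψ (-2) * ψ.coeff 0 + 2 * φ.coeff 1 * n * dCoef φ ψ (n - 1)) /
      (dCoef φ ψ (2 * n) * dCoef φ ψ (2 * n - 2))) := by
  obtain ⟨n, rfl⟩ : ∃ k, n = k + 1 := ⟨n - 1, by omega⟩
  have h0 := dCoef_ne_zero hP h (k := 2 * n) (by omega)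
  have h1 := dCoef_ne_zero hP h (k := 2 * n + 2) (by omega)
  rw [recBeta_succ hP, coeff_succ_self hP h, coeff_succ_self hP h,
    show 2 * ((n + 1 : ℕ) : ℤ) = 2 * n + 2 by push_cast; ring, add_sub_cancel_right]
  rw [neg_div', eq_div_iff (mul_ne_zero h1 h0)]
  field_simp
  simp only [dCoef, eCoef]
  push_cast
  ring

/-- This is the identity that makes the cross terms match in McCarthy's relation. -/
lemma recBeta_recurrence (hP : IsMonicOPS u P) (h : C1At u φ ψ) (n : ℕ) :
    dCoef φ ψ (2 * n + 2) * recBeta u P (n + 1) =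
      dCoef φ ψ (2 * n - 2) * recBeta u P n - 2 * φ.coeff 1 := by
  have h1 := dCoef_ne_zero hP h (k := 2 * n) (by omega)
  have h2 := dCoef_ne_zero hP h (k := 2 * n + 2) (by omega)
  have b1 := recBeta_eq hP h (n := n + 1) (by omega)
  push_cast at b1
  rw [show 2 * ((n : ℤ) + 1) - 2 = 2 * n by ring, show 2 * ((n : ℤ) + 1) = 2 * n + 2 by ring,
    show (n : ℤ) + 1 - 1 = n by ring] at b1
  have d1 : dCoef φ ψ (2 * n) = 2 * n * φ.coeff 2 + ψ.coeff 1 := by simp [dCoef]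
  -- The index zero is separate: the closed form would divide by `d_{-2}`, which may vanish for an
  -- admissible pair.
  rcases n with _ | n
  · rw [b1, recBeta_zero_eq hP h]
    simp only [Nat.cast_zero, mul_zero, zero_add, zero_sub] at h1 h2 ⊢
    field_simp
    simp only [dCoef, eCoef]
    push_cast
    ring
  · have h0 := dCoef_ne_zero hP h (k := 2 * n) (by omega)
    have b0 := recBeta_eq hP h (n := n + 1) (by omega)
    rw [b1, b0]
    push_cast at h1 h2 d1 ⊢
    rw [show 2 * ((n : ℤ) + 1) - 2 = 2 * n by ring]
    field_simp
    rw [d1]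
    simp only [dCoef]
    push_cast
    ring

lemma eval_quadratic (hφ : φ.natDegree ≤ 2) (x : ℂ) :
    φ.eval x = φ.coeff 2 * x ^ 2 + φ.coeff 1 * x + φ.coeff 0 := by
  conv_lhs => rw [eq_quadratic hφ]
  simp

/-- Separate from the general formula, which at `n = 1` would have `d_{-1}`, possibly zero, in both
numerator and denominator. -/
lemma recGamma_one_eq (hP : IsMonicOPS u P) (h : C1At u φ ψ) :
    recGamma u P 1 = -(1 / dCoef φ ψ 1) * φ.eval (-(eCoef φ ψ 0 / dCoef φ ψ 0)) := by
  have h0 := dCoef_ne_zero hP h (k := 0) (by omega)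
  have h1 := dCoef_ne_zero hP h (k := 1) (by omega)
  have h2 := dCoef_ne_zero hP h (k := 2) (by omega)
  have c0 := coeff_succ_self hP h 0
  have c1 := coeff_add_two_self hP h 0
  have b1 := recBeta_eq hP h (n := 1) le_rfl
  rw [recGamma_one hP, b1]
  simp only [zero_add] at c0 c1
  rw [c0, c1]
  rw [eval_quadratic h.2.1]
  simp only [dCoef, eCoef] at h0 h1 h2 ⊢
  push_cast at h0 h1 h2 ⊢
  generalize φ.coeff 2 = a at *
  generalize ψ.coeff 1 = p at *
  simp only [zero_mul, mul_one, zero_add, one_mul] at h0 h1 h2 ⊢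
  field_simp
  ring

lemma recGamma_eq (hP : IsMonicOPS u P) (h : C1At u φ ψ) {n : ℕ} (hn : 2 ≤ n) :
    recGamma u P n =
      -((n * dCoef φ ψ (n - 2)) / (dCoef φ ψ (2 * n - 3) * dCoef φ ψ (2 * n - 1))) *
        φ.eval (-(eCoef φ ψ (n - 1) / dCoef φ ψ (2 * n - 2))) := by
  obtain ⟨n, rfl⟩ : ∃ k, n = k + 2 := ⟨n - 2, by omega⟩
  have h1 := dCoef_ne_zero hP h (k := 2 * n + 1) (by omega)
  have h2 := dCoef_ne_zero hP h (k := 2 * n + 2) (by omega)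
  have h3 := dCoef_ne_zero hP h (k := 2 * n + 3) (by omega)
  have h4 := dCoef_ne_zero hP h (k := 2 * n + 4) (by omega)
  have b := recBeta_eq hP h (n := n + 2) (by omega)
  have c1 := coeff_add_two_self hP h n
  have c2 := coeff_add_two_self hP h (n + 1)
  have c3 := coeff_succ_self hP h (n + 1)
  push_cast at b c1 c2 c3 ⊢
  rw [show 2 * ((n : ℤ) + 2) - 2 = 2 * n + 2 by ring, show 2 * ((n : ℤ) + 2) = 2 * n + 4 by ring]
    at b
  rw [show 2 * ((n : ℤ) + 1) + 2 = 2 * n + 4 by ring,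
    show 2 * ((n : ℤ) + 1) + 1 = 2 * n + 3 by ring] at c2
  rw [show 2 * ((n : ℤ) + 1) = 2 * n + 2 by ring] at c3
  rw [show 2 * ((n : ℤ) + 2) - 3 = 2 * n + 1 by ring, show 2 * ((n : ℤ) + 2) - 1 = 2 * n + 3 by ring,
    show 2 * ((n : ℤ) + 2) - 2 = 2 * n + 2 by ring]
  rw [recGamma_add_two hP, b, c1, c2, c3]
  rw [eval_quadratic h.2.1]
  have d1 : dCoef φ ψ (2 * n + 1) = (2 * n + 1) * φ.coeff 2 + ψ.coeff 1 := by simp [dCoef]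
  have d2 : dCoef φ ψ (2 * n + 2) = (2 * n + 2) * φ.coeff 2 + ψ.coeff 1 := by simp [dCoef]
  have d3 : dCoef φ ψ (2 * n + 3) = (2 * n + 3) * φ.coeff 2 + ψ.coeff 1 := by simp [dCoef]
  have d4 : dCoef φ ψ (2 * n + 4) = (2 * n + 4) * φ.coeff 2 + ψ.coeff 1 := by simp [dCoef]
  field_simp
  rw [d1, d2, d3, d4]
  simp only [dCoef, eCoef]
  push_cast
  ring

end Recurrence

/-! ### The structure relation -/

lemma coeff_pearson_succ (hφ : φ.natDegree ≤ 2) (hψ : ψ.natDegree ≤ 1) (q : ℂ[X]) (n : ℕ) :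
    (φ * derivative q + ψ * q).coeff (n + 1) = dCoef φ ψ n * q.coeff n
      + eCoef φ ψ (n + 1) * q.coeff (n + 1) + (n + 2) * φ.coeff 0 * q.coeff (n + 2) := by
  obtain ⟨p, rfl⟩ := derivative_surjective q
  rw [coeff_bochner hφ hψ]
  simp only [coeff_derivative]
  push_cast
  rw [add_sub_cancel_right]
  ring

lemma coeff_mul_derivative_succ (hφ : φ.natDegree ≤ 2) (q : ℂ[X]) (n : ℕ) :
    (φ * derivative q).coeff (n + 1) = n * φ.coeff 2 * q.coeff n
      + (n + 1) * φ.coeff 1 * q.coeff (n + 1) + (n + 2) * φ.coeff 0 * q.coeff (n + 2) := by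
  have := coeff_pearson_succ hφ (ψ := 0) (by simp) q n
  rw [zero_mul, add_zero] at this
  rw [this]
  simp [dCoef, eCoef]

lemma degree_mul_derivative_lt (hP : IsMonicOPS u P) (hφ : φ.natDegree ≤ 2) (n : ℕ) :
    (φ * derivative (P n)).degree < (n + 2 : ℕ) := by
  rw [degree_lt_iff_coeff_zero]
  intro m hm
  obtain ⟨m, rfl⟩ : ∃ k, m = k + 1 := ⟨m - 1, by omega⟩
  rw [coeff_mul_derivative_succ hφ, hP.coeff_of_lt (m := m) (by omega),
    hP.coeff_of_lt (m := m + 1) (by omega), hP.coeff_of_lt (m := m + 2) (by omega)]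
  ring

lemma apply_structure_of_lt (hP : IsMonicOPS u P) (hφ : φ.natDegree ≤ 2) {n m : ℕ}
    (h : n + 2 ≤ m) : u (φ * derivative (P n) * P m) = 0 :=
  hP.apply_mul_of_degree_lt ((degree_mul_derivative_lt hP hφ n).trans_le (by exact_mod_cast h))

lemma apply_structure_succ (hP : IsMonicOPS u P) (hφ : φ.natDegree ≤ 2) (n : ℕ) :
    u (φ * derivative (P n) * P (n + 1)) = n * φ.coeff 2 * u (P (n + 1) * P (n + 1)) := by
  rw [hP.apply_mul (degree_mul_derivative_lt hP hφ n), coeff_mul_derivative_succ hφ,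
    hP.coeff_self, hP.coeff_of_lt (m := n + 1) (by omega),
    hP.coeff_of_lt (m := n + 2) (by omega)]
  ring

lemma apply_psi_mul_mul (hP : IsMonicOPS u P) (hψ : ψ.natDegree ≤ 1) (n : ℕ) :
    u (ψ * P n * P n) = ψ.eval (recBeta u P n) * u (P n * P n) := by
  have h1 : ψ * P n * P n = C (ψ.coeff 1) * (X * P n * P n) + C (ψ.coeff 0) * (P n * P n) := by
    conv_lhs => rw [eq_X_add_C_of_natDegree_le_one hψ]
    ring
  have h2 : ψ.eval (recBeta u P n) = ψ.coeff 1 * recBeta u P n + ψ.coeff 0 := by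
    conv_lhs => rw [eq_X_add_C_of_natDegree_le_one hψ]
    simp
  rw [h1, h2, map_add, map_C_mul, map_C_mul, hP.apply_X_mul_mul]
  ring

lemma apply_structure_self (hP : IsMonicOPS u P) (h : C1At u φ ψ) (n : ℕ) :
    u (φ * derivative (P n) * P n) =
      -(1 / 2) * ψ.eval (recBeta u P n) * u (P n * P n) := by
  have h1 := pearson_iff.1 h.2.2.2.2 (P n * P n)
  rw [mul_assoc _ _ (u _), ← apply_psi_mul_mul hP h.2.2.2.1]
  have h2 : φ * derivative (P n * P n) + ψ * (P n * P n) =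
      C 2 * (φ * derivative (P n) * P n) + ψ * P n * P n := by
    rw [derivative_mul, map_ofNat]
    ring
  rw [h2, map_add, map_C_mul] at h1
  linear_combination h1 / 2

lemma apply_structure (h : C1At u φ ψ) (n : ℕ) (q : ℂ[X]) :
    u (φ * derivative (P n) * q) = -u ((φ * derivative q + ψ * q) * P n) := by
  have h1 := pearson_iff.1 h.2.2.2.2 (P n * q)
  rw [eq_neg_iff_add_eq_zero, ← map_add, ← h1, derivative_mul]
  congr 1
  ring

lemma degree_pearson_lt (hP : IsMonicOPS u P) (h : C1At u φ ψ) (n : ℕ) :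
    (φ * derivative (P n) + ψ * P n).degree < (n + 2 : ℕ) := by
  refine (degree_add_le _ _).trans_lt (max_lt (degree_mul_derivative_lt hP h.2.1 n) ?_)
  refine degree_le_natDegree.trans_lt ?_
  have := natDegree_mul_le (p := ψ) (q := P n)
  rw [hP.natDegree_eq] at this
  have := h.2.2.2.1
  exact_mod_cast (by omega : (ψ * P n).natDegree < n + 2)

lemma apply_structure_pred (hP : IsMonicOPS u P) (h : C1At u φ ψ) (n : ℕ) :
    u (φ * derivative (P (n + 1)) * P n) = -(dCoef φ ψ n * u (P (n + 1) * P (n + 1))) := by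
  rw [apply_structure h, hP.apply_mul (degree_pearson_lt hP h n),
    coeff_pearson_succ h.2.1 h.2.2.2.1, hP.coeff_self,
    hP.coeff_of_lt (m := n + 1) (by omega), hP.coeff_of_lt (m := n + 2) (by omega)]
  ring

lemma apply_structure_of_gt (hP : IsMonicOPS u P) (h : C1At u φ ψ) {n m : ℕ} (hm : m + 2 ≤ n) :
    u (φ * derivative (P n) * P m) = 0 := by
  rw [apply_structure h, hP.apply_mul_of_degree_lt, neg_zero]
  exact (degree_pearson_lt hP h m).trans_le (by exact_mod_cast hm)

lemma apply_prev_mul_of_ne (hP : IsMonicOPS u P) {n j : ℕ} (hj : j + 1 ≠ n) :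
    u (prev P n * P j) = 0 := by
  cases n with
  | zero => simp [prev]
  | succ n => exact hP.apply_mul_of_ne (by omega)

lemma apply_combination (a b c : ℂ) (n : ℕ) (q : ℂ[X]) :
    u ((C a * P (n + 1) + C b * P n + C c * prev P n) * q) =
      a * u (P (n + 1) * q) + b * u (P n * q) + c * u (prev P n * q) := by
  simp only [add_mul, map_add, mul_assoc, map_C_mul]

/-- Both sides are paired with every `P_j`. Degree settles `j > n`, integration by parts settles `j
< n`, and Pearson's equation tested on `P_n²` settles `j = n`, whence the factor one half. -/
lemma structureEq_of_c1At (hP : IsMonicOPS u P) (h : C1At u φ ψ) (n : ℕ) :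
    StructureEq P φ n (n * φ.coeff 2) (-(1 / 2) * ψ.eval (recBeta u P n))
      (-(dCoef φ ψ (n - 1) * recGamma u P n)) := by
  rw [StructureEq, ← sub_eq_zero]
  refine hP.eq_zero_of_forall fun j => ?_
  rw [sub_mul, map_sub, apply_combination]
  rcases (by omega : j = n + 1 ∨ j = n ∨ j + 1 = n ∨ n + 2 ≤ j ∨ j + 2 ≤ n) with
    rfl | rfl | rfl | hj | hj
  · rw [apply_structure_succ hP h.2.1, hP.apply_mul_of_ne (m := n) (by omega),
      apply_prev_mul_of_ne hP (by omega)]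
    ring
  · rw [apply_structure_self hP h, hP.apply_mul_of_ne (m := j + 1) (by omega),
      apply_prev_mul_of_ne hP (by omega)]
    ring
  · rw [apply_structure_pred hP h, hP.apply_mul_of_ne (m := j + 1 + 1) (by omega),
      hP.apply_mul_of_ne (m := j + 1) (n := j) (by omega), prev, hP.norm_succ]
    push_cast
    rw [add_sub_cancel_right]
    ring
  · rw [apply_structure_of_lt hP h.2.1 hj, hP.apply_mul_of_ne (m := n + 1) (by omega),
      hP.apply_mul_of_ne (m := n) (by omega), apply_prev_mul_of_ne hP (by omega)]
    ring
  · rw [apply_structure_of_gt hP h hj, hP.apply_mul_of_ne (m := n + 1) (by omega),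
      hP.apply_mul_of_ne (m := n) (by omega), apply_prev_mul_of_ne hP (by omega)]
    ring

lemma combination_eq_zero (hP : IsMonicOPS u P) {a b c : ℂ} {n : ℕ}
    (h : C a * P (n + 1) + C b * P n + C c * prev P n = 0) : a = 0 ∧ b = 0 ∧ (1 ≤ n → c = 0) := by
  have key : ∀ j, a * u (P (n + 1) * P j) + b * u (P n * P j) + c * u (prev P n * P j) = 0 := by
    intro j
    rw [← apply_combination, h, zero_mul, map_zero]
  refine ⟨?_, ?_, fun hn => ?_⟩
  · have := key (n + 1)
    rw [hP.apply_mul_of_ne (m := n) (by omega), apply_prev_mul_of_ne hP (by omega)] at this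
    simpa [hP.norm_ne_zero] using this
  · have := key n
    rw [hP.apply_mul_of_ne (m := n + 1) (by omega), apply_prev_mul_of_ne hP (by omega)] at this
    simpa [hP.norm_ne_zero] using this
  · obtain ⟨n, rfl⟩ : ∃ k, n = k + 1 := ⟨n - 1, by omega⟩
    have := key n
    rw [hP.apply_mul_of_ne (m := n + 1) (by omega), hP.apply_mul_of_ne (m := n + 1 + 1) (by omega)]
      at this
    simpa [hP.norm_ne_zero, prev] using this

lemma structureEq_iff (hP : IsMonicOPS u P) (h : C1At u φ ψ) (n : ℕ) (a b c : ℂ) :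
    StructureEq P φ n a b c ↔ a = n * φ.coeff 2 ∧ b = -(1 / 2) * ψ.eval (recBeta u P n) ∧
      (1 ≤ n → c = -(dCoef φ ψ (n - 1) * recGamma u P n)) := by
  have h0 := structureEq_of_c1At hP h n
  constructor
  · intro h1
    have h2 := combination_eq_zero hP (n := n) (a := a - n * φ.coeff 2)
      (b := b - -(1 / 2) * ψ.eval (recBeta u P n))
      (c := c - -(dCoef φ ψ (n - 1) * recGamma u P n)) (by
        rw [StructureEq] at h0 h1
        rw [C_sub, C_sub, C_sub]
        linear_combination h0 - h1)
    exact ⟨sub_eq_zero.1 h2.1, sub_eq_zero.1 h2.2.1, fun hn => sub_eq_zero.1 (h2.2.2 hn)⟩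
  · rintro ⟨rfl, rfl, h3⟩
    rcases n with _ | n
    · simpa [StructureEq, prev] using h0
    · rw [h3 (by omega)]
      exact h0

lemma c2At_of_c1At (hP : IsMonicOPS u P) (h : C1At u φ ψ) : C2At P φ := by
  refine ⟨h.2.1, _, _, _, fun n hn => ?_, structureEq_of_c1At hP h⟩
  exact neg_ne_zero.2 (mul_ne_zero (dCoef_ne_zero hP h (by omega)) (hP.recGamma_ne_zero n))

lemma exists_pearson (hP : IsMonicOPS u P) (h : ∀ n, 2 ≤ n → u (φ * derivative (P n)) = 0) :
    ∃ ψ : ℂ[X], ψ.natDegree ≤ 1 ∧ Pearson u φ ψ := by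
  obtain ⟨ψ, hd, hψ⟩ := hP.exists_eq_leftMul (v := distDeriv (leftMul φ u)) (N := 2)
    fun n hn => by rw [distDeriv_apply, leftMul_apply, h n hn, neg_zero]
  exact ⟨ψ, natDegree_le_of_degree_le (Order.le_of_lt_succ hd), hψ⟩

lemma c1At_of_c2At (hP : IsMonicOPS u P) (h : C2At P φ) : ∃ ψ, C1At u φ ψ := by
  obtain ⟨hφ, a, b, c, hc, h⟩ := h
  obtain ⟨ψ, hψ, hpear⟩ := exists_pearson (φ := φ) hP fun n hn => by
    obtain ⟨n, rfl⟩ : ∃ k, n = k + 1 := ⟨n - 1, by omega⟩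
    rw [h (n + 1), ← mul_one (_ + _), apply_combination, mul_one, mul_one, mul_one, prev,
      hP.apply_eq_zero (by omega), hP.apply_eq_zero (by omega), hP.apply_eq_zero (by omega)]
    ring
  have hφ0 : φ ≠ 0 := by
    rintro rfl
    have := h 1
    rw [StructureEq, zero_mul, eq_comm] at this
    exact hc 1 le_rfl ((combination_eq_zero hP this).2.2 le_rfl)
  exact ⟨ψ, hφ0, hφ, hpear.psi_ne_zero hP hφ0, hψ, hpear⟩

/-! ### McCarthy's relation -/

lemma mcCarthyEq_of_c1At (hP : IsMonicOPS u P) (h : C1At u φ ψ) (n : ℕ) :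
    McCarthyEq P φ ψ (n + 1) (dCoef φ ψ (2 * (n + 1 : ℕ) - 3))
      (-(dCoef φ ψ (2 * (n + 1 : ℕ) - 1) * recGamma u P (n + 1))) := by
  have s1 := structureEq_of_c1At hP h (n + 1)
  have s0 := structureEq_of_c1At hP h n
  have t1 := hP.ttrr.2 (n + 1)
  have t0 := hP.ttrr.2 n
  have hb := recBeta_recurrence hP h n
  -- Through the recurrence, both `φ P_{n+1}'` and `φ P_n'` are written in `P_{n+1}` and `P_n`
  -- alone, eliminating `P_{n+2}` here and `P_{n-1}` in `e0`. The product rule then leaves only the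
  -- cross coefficient, computed in `key`.
  have e1 : φ * derivative (P (n + 1)) =
      (C ((n + 1) * φ.coeff 2) * (X - C (recBeta u P (n + 1)))
        + C (-(1 / 2) * ψ.eval (recBeta u P (n + 1)))) * P (n + 1)
      + C (-(dCoef φ ψ (2 * n + 1) * recGamma u P (n + 1))) * P n := by
    rw [s1, t1, prev]
    have : (C (-(dCoef φ ψ (2 * n + 1) * recGamma u P (n + 1))) : ℂ[X]) =
      C (-(dCoef φ ψ ((n + 1 : ℕ) - 1) * recGamma u P (n + 1)))
        - C ((n + 1) * φ.coeff 2) * C (recGamma u P (n + 1)) := by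
      rw [← C_mul, ← C_sub]
      congr 1
      simp only [dCoef]
      push_cast
      ring
    rw [this]
    push_cast
    ring
  have e0 : φ * derivative (P n) = C (dCoef φ ψ (2 * n - 1)) * P (n + 1)
      + (C (-(1 / 2) * ψ.eval (recBeta u P n))
        - C (dCoef φ ψ (n - 1)) * (X - C (recBeta u P n))) * P n := by
    have h1 : (C (dCoef φ ψ (2 * n - 1)) : ℂ[X]) = C (n * φ.coeff 2) + C (dCoef φ ψ (n - 1)) := by
      rw [← C_add]
      congr 1
      simp only [dCoef]
      push_cast
      ring
    rw [s0, h1, C_neg, C_mul (a := dCoef φ ψ (n - 1)) (b := recGamma u P n)]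
    linear_combination -C (dCoef φ ψ (n - 1)) * t0
  have ev : ∀ x, ψ.eval x = ψ.coeff 1 * x + ψ.coeff 0 := by
    intro x
    conv_lhs => rw [eq_X_add_C_of_natDegree_le_one h.2.2.2.1]
    simp
  have hdφ : derivative φ = C (2 * φ.coeff 2) * X + C (φ.coeff 1) := by
    conv_lhs => rw [eq_quadratic h.2.1]
    simp
    rw [one_add_one_eq_two, map_ofNat]
    ring
  have key : C ((n + 1) * φ.coeff 2) * (X - C (recBeta u P (n + 1)))
        + C (-(1 / 2) * ψ.eval (recBeta u P (n + 1)))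
        + (C (-(1 / 2) * ψ.eval (recBeta u P n))
          - C (dCoef φ ψ (n - 1)) * (X - C (recBeta u P n))) = -(ψ - derivative φ) := by
    have h1 : (C ((n + 1) * φ.coeff 2) : ℂ[X]) - C (dCoef φ ψ (n - 1)) =
        C (2 * φ.coeff 2) - C (ψ.coeff 1) := by
      rw [← C_sub, ← C_sub]
      congr 1
      simp only [dCoef]
      push_cast
      ring
    have h2 : -(C ((n + 1) * φ.coeff 2) * C (recBeta u P (n + 1)))
        + C (-(1 / 2) * ψ.eval (recBeta u P (n + 1))) + C (-(1 / 2) * ψ.eval (recBeta u P n))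
        + C (dCoef φ ψ (n - 1)) * C (recBeta u P n) = C (φ.coeff 1) - C (ψ.coeff 0) := by
      rw [← C_mul, ← C_mul, ← C_neg, ← C_add, ← C_add, ← C_add, ← C_sub]
      congr 1
      rw [ev, ev]
      simp only [dCoef] at hb ⊢
      push_cast at hb ⊢
      linear_combination -hb / 2
    rw [hdφ]
    conv_rhs => rw [eq_X_add_C_of_natDegree_le_one h.2.2.2.1]
    linear_combination X * h1 + h2
  have i1 : 2 * ((n + 1 : ℕ) : ℤ) - 3 = 2 * n - 1 := by push_cast; ring
  have i2 : 2 * ((n + 1 : ℕ) : ℤ) - 1 = 2 * n + 1 := by push_cast; ring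
  rw [McCarthyEq, Nat.add_sub_cancel, derivative_mul, i1, i2]
  linear_combination P n * e1 + P (n + 1) * e0 + P n * P (n + 1) * key

lemma mcCarthyEq_iff (hP : IsMonicOPS u P) (h : C1At u φ ψ) {n : ℕ} (hn : 1 ≤ n) (k t : ℂ) :
    McCarthyEq P φ ψ n k t ↔
      k = dCoef φ ψ (2 * n - 3) ∧ t = -(dCoef φ ψ (2 * n - 1) * recGamma u P n) := by
  obtain ⟨n, rfl⟩ : ∃ k, n = k + 1 := ⟨n - 1, by omega⟩
  have h0 := mcCarthyEq_of_c1At hP h n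
  constructor
  · intro h1
    rw [McCarthyEq, Nat.add_sub_cancel] at h0 h1
    set k0 := dCoef φ ψ (2 * (n + 1 : ℕ) - 3)
    set t0 := -(dCoef φ ψ (2 * (n + 1 : ℕ) - 1) * recGamma u P (n + 1))
    have h2 : C (k - k0) * P (n + 1) ^ 2 + C (t - t0) * P n ^ 2 = 0 := by
      rw [C_sub, C_sub]
      linear_combination h0 - h1
    have hd : ∀ n, (P n ^ 2).natDegree = 2 * n := fun n => by
      rw [natDegree_pow, hP.natDegree_eq]
    have hk : k - k0 = 0 := by
      have h3 := congrArg (fun p => coeff p (2 * (n + 1))) h2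
      simp only [coeff_add, coeff_C_mul, coeff_zero] at h3
      rw [coeff_eq_zero_of_natDegree_lt (p := P n ^ 2) (by rw [hd]; omega), ← hd (n + 1),
        coeff_natDegree, ((hP.monic _).pow 2).leadingCoeff] at h3
      simpa using h3
    rw [hk, C_0, zero_mul, zero_add, mul_eq_zero, C_eq_zero,
      or_iff_left (pow_ne_zero 2 (hP.ne_zero n))] at h2
    exact ⟨sub_eq_zero.1 hk, sub_eq_zero.1 h2⟩
  · rintro ⟨rfl, rfl⟩
    exact h0

lemma c7At_of_c1At (hP : IsMonicOPS u P) (h : C1At u φ ψ) : C7At P φ ψ :=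
  ⟨((c1At_iff_c1At' hP).1 h).1, _, _, fun _ hn => (mcCarthyEq_iff hP h hn _ _).2 ⟨rfl, rfl⟩⟩

/-- The recurrence is a step of Euclid's algorithm with the unit remainder factor `-γ_{n+1}`. -/
lemma isCoprime_succ (hP : IsMonicOPS u P) (n : ℕ) : IsCoprime (P (n + 1)) (P n) := by
  induction n with
  | zero =>
    rw [hP.zero_eq]
    exact isCoprime_one_right
  | succ n ih =>
    have h1 : P (n + 1 + 1) = C (-recGamma u P (n + 1)) * P n
        + P (n + 1) * (X - C (recBeta u P (n + 1))) := by
      rw [hP.ttrr.2 (n + 1), prev, C_neg]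
      ring
    rw [h1]
    refine IsCoprime.add_mul_left_left ?_ _
    rw [isCoprime_mul_unit_left_left
      (isUnit_C.2 (neg_ne_zero.2 (hP.recGamma_ne_zero _)).isUnit)]
    exact ih.symm

lemma C_eq_zero_of_dvd (hP : IsMonicOPS u P) {n : ℕ} (hn : 1 ≤ n) {c : ℂ} (h : P n ∣ C c) :
    c = 0 := by
  by_contra hc
  have := natDegree_le_of_dvd h (C_ne_zero.2 hc)
  rw [hP.natDegree_eq, natDegree_C] at this
  omega

/-- By coprimality `P_1` divides the constant `k` and `P_2` divides the constant `t`, so both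
vanish. Index 2 is used because `P_0 = 1` would give no information. -/
lemma eq_zero_of_mcCarthy (hP : IsMonicOPS u P) {k t : ℂ} {χ : ℂ[X]}
    (h : C k * P 2 ^ 2 - χ * (P 2 * P 1) + C t * P 1 ^ 2 = 0) : χ = 0 := by
  have hco := isCoprime_succ hP 1
  have hk : k = 0 := by
    refine C_eq_zero_of_dvd hP (n := 1) le_rfl ((hco.symm.pow_right (n := 2)).dvd_of_dvd_mul_right
      ⟨χ * P 2 - C t * P 1, ?_⟩)
    linear_combination h
  have ht : t = 0 := by
    refine C_eq_zero_of_dvd hP (n := 2) (by omega) ((hco.pow_right (n := 2)).dvd_of_dvd_mul_right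
      ⟨χ * P 1 - C k * P 2, ?_⟩)
    linear_combination h
  rw [hk, ht, C_0, zero_mul, zero_mul, zero_sub, add_zero, neg_eq_zero] at h
  exact (mul_eq_zero.1 h).resolve_right (mul_ne_zero (hP.ne_zero 2) (hP.ne_zero 1))

lemma c1At_of_c7At (hP : IsMonicOPS u P) (h : C7At P φ ψ) : C1At u φ ψ := by
  obtain ⟨hadm, k, t, h⟩ := h
  obtain ⟨hφ, hψ, hd⟩ := hadm
  have hφ0 : φ ≠ 0 := by
    rintro rfl
    have h2 := h 2 (by omega)
    rw [McCarthyEq] at h2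
    have h3 : ψ = 0 := eq_zero_of_mcCarthy hP (k := k 2) (t := t 2) (by
      rw [derivative_zero, sub_zero, zero_mul] at h2
      exact h2.symm)
    refine hd 0 ?_
    simp [h3, dCoef]
  obtain ⟨ψ', hψ', hpear⟩ := exists_pearson (φ := φ) hP fun n hn => by
    obtain ⟨n, rfl⟩ : ∃ k, n = k + 1 := ⟨n - 1, by omega⟩
    have h1 := h (n + 1) (by omega)
    rw [McCarthyEq, derivative_mul, Nat.add_sub_cancel] at h1
    -- Modulo `P_{n+1}` the relation reads `P_n (φ P_{n+1}' - t P_n) = 0`, and `P_n` is invertible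
    -- there. The quotient has degree at most one, so `u` kills `φ P_{n+1}'`.
    obtain ⟨A, hA⟩ : P (n + 1) ∣ φ * derivative (P (n + 1)) - C (t (n + 1)) * P n := by
      refine (isCoprime_succ hP n).dvd_of_dvd_mul_right
        ⟨C (k (n + 1)) * P (n + 1) - (ψ - derivative φ) * P n - φ * derivative (P n), ?_⟩
      linear_combination h1
    have hA1 : A.degree < 2 := by
      have hdeg : (P (n + 1) * A).degree < (n + 1 + 2 : ℕ) := by
        rw [← hA]
        refine (degree_sub_le _ _).trans_lt (max_lt (degree_mul_derivative_lt hP hφ _) ?_)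
        rw [← smul_eq_C_mul]
        refine (degree_smul_le _ _).trans_lt ?_
        rw [hP.degree_eq]
        exact_mod_cast (by omega : n < n + 1 + 2)
      rw [degree_mul, hP.degree_eq, Nat.cast_add (n + 1) 2] at hdeg
      exact lt_of_add_lt_add_left hdeg
    rw [show φ * derivative (P (n + 1)) = A * P (n + 1) + C (t (n + 1)) * P n by
        linear_combination hA, map_add, map_C_mul, hP.apply_eq_zero (n := n) (by omega),
      hP.apply_mul_of_degree_lt (hA1.trans_le (by exact_mod_cast hn))]
    ring
  have hC1 : C1At u φ ψ' := ⟨hφ0, hφ, hpear.psi_ne_zero hP hφ0, hψ', hpear⟩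
  -- It remains to identify `ψ'` with `ψ`: McCarthy's relation holds with both, and the two
  -- instances at `n = 2` are subtracted.
  have h2 := h 2 (by omega)
  have h2' := mcCarthyEq_of_c1At hP hC1 1
  rw [McCarthyEq] at h2 h2'
  set k' := dCoef φ ψ' (2 * (1 + 1 : ℕ) - 3)
  set t' := -(dCoef φ ψ' (2 * (1 + 1 : ℕ) - 1) * recGamma u P (1 + 1))
  have h3 : ψ - ψ' = 0 := eq_zero_of_mcCarthy hP (k := k 2 - k') (t := t 2 - t') (by
    rw [C_sub, C_sub]
    linear_combination h2' - h2)
  rwa [sub_eq_zero.1 h3]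

/-! ### The Stieltjes series and moments -/

lemma coeff_polyInZ_mul (hφ : φ.natDegree ≤ 2) (f : LaurentSeries ℂ) (k : ℤ) :
    (polyInZ φ * f).coeff k =
      φ.coeff 2 * f.coeff (k + 2) + φ.coeff 1 * f.coeff (k + 1) + φ.coeff 0 * f.coeff k := by
  have h1 : polyInZ φ = HahnSeries.single (-2 : ℤ) (φ.coeff 2)
      + HahnSeries.single (-1 : ℤ) (φ.coeff 1) + HahnSeries.single (0 : ℤ) (φ.coeff 0) := by
    conv_lhs => rw [eq_quadratic hφ]
    simp only [polyInZ, eval₂_add, eval₂_mul, eval₂_C, eval₂_pow, eval₂_X, HahnSeries.C_apply,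
      HahnSeries.single_pow, HahnSeries.single_mul_single]
    norm_num
  rw [h1, add_mul, add_mul, HahnSeries.coeff_add, HahnSeries.coeff_add,
    HahnSeries.coeff_single_mul, HahnSeries.coeff_single_mul, HahnSeries.coeff_single_mul]
  simp only [sub_neg_eq_add, sub_zero]

lemma coeff_zDeriv (f : LaurentSeries ℂ) (k : ℤ) :
    (zDeriv f).coeff k = -((k - 1) * f.coeff (k - 1)) := by
  rw [zDeriv, HahnSeries.coeff_neg, HahnSeries.coeff_single_mul, LaurentSeries.derivative_apply,
    LaurentSeries.hasseDeriv_coeff]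
  simp only [one_mul, Nat.cast_one, Ring.choose_one_right]
  rw [show k - 2 + 1 = k - 1 by ring, zsmul_eq_mul]
  push_cast
  ring

lemma coeff_stieltjes_succ (u : Module.Dual ℂ ℂ[X]) (n : ℕ) :
    (stieltjes u).coeff (n + 1) = -moment u n := by
  rw [stieltjes, HahnSeries.coeff_neg, HahnSeries.coeff_single_mul, add_sub_cancel_right,
    LaurentSeries.coeff_coe_powerSeries, PowerSeries.coeff_mk, one_mul]

lemma coeff_stieltjes_of_nonpos (u : Module.Dual ℂ ℂ[X]) {k : ℤ} (hk : k ≤ 0) :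
    (stieltjes u).coeff k = 0 := by
  rw [stieltjes, HahnSeries.coeff_neg, HahnSeries.coeff_single_mul, PowerSeries.coeff_coe,
    if_pos (by omega), mul_zero, neg_zero]

lemma pearson_iff_moment (hφ : φ.natDegree ≤ 2) (hψ : ψ.natDegree ≤ 1) :
    Pearson u φ ψ ↔ ∀ n : ℕ, dCoef φ ψ n * moment u (n + 1) + eCoef φ ψ n * moment u n
      + n * φ.coeff 0 * moment u (n - 1) = 0 := by
  have key : ∀ n : ℕ, u (φ * derivative (X ^ n) + ψ * X ^ n) = dCoef φ ψ n * moment u (n + 1)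
      + eCoef φ ψ n * moment u n + n * φ.coeff 0 * moment u (n - 1) := by
    intro n
    have h1 : φ * derivative (X ^ n) + ψ * X ^ n = C (dCoef φ ψ n) * X ^ (n + 1)
        + C (eCoef φ ψ n) * X ^ n + C (n * φ.coeff 0) * X ^ (n - 1) := by
      conv_lhs => rw [eq_quadratic hφ, eq_X_add_C_of_natDegree_le_one hψ]
      rcases n with _ | n
      · simp [dCoef, eCoef]
      · simp [dCoef, eCoef]
        ring
    rw [h1, map_add, map_add, map_C_mul, map_C_mul, map_C_mul]
    rfl
  rw [pearson_iff]
  constructor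
  · intro h n
    rw [← key, h]
  · intro h q
    induction q using Polynomial.induction_on' with
    | add p q hp hq =>
      have h1 : φ * derivative (p + q) + ψ * (p + q) =
          (φ * derivative p + ψ * p) + (φ * derivative q + ψ * q) := by
        rw [derivative_add]
        ring
      rw [h1, map_add, hp, hq, add_zero]
    | monomial n c =>
      rw [← C_mul_X_pow_eq_monomial, derivative_C_mul]
      have h1 : φ * (C c * derivative (X ^ n)) + ψ * (C c * X ^ n) =
          C c * (φ * derivative (X ^ n) + ψ * X ^ n) := by ring
      rw [h1, map_C_mul, key, h, mul_zero]

/-- The coefficient of `w^(n+1)` is the moment form of Pearson's equation tested on `x^n`;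
coefficients with nonpositive exponent agree identically. -/
lemma c6At_iff_c1At' : C6At u φ ψ ↔ C1At' u φ ψ := by
  refine and_congr_right fun hadm => ?_
  obtain ⟨hφ, hψ, -⟩ := hadm
  rw [pearson_iff_moment hφ hψ]
  have hdφ : derivative φ = C (2 * φ.coeff 2) * X + C (φ.coeff 1) := by
    conv_lhs => rw [eq_quadratic hφ]
    simp
    rw [one_add_one_eq_two, map_ofNat]
    ring
  have hψe := eq_X_add_C_of_natDegree_le_one hψ
  have hχ : ψ - derivative φ = C (ψ.coeff 1 - 2 * φ.coeff 2) * X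
      + C (ψ.coeff 0 - φ.coeff 1) := by
    conv_lhs => rw [hdφ, hψe]
    rw [C_sub, C_sub]
    ring
  have hχ2 : (ψ - derivative φ).natDegree ≤ 2 := by
    rw [hχ]
    exact natDegree_linear_le.trans one_le_two
  have hc : (derivative ψ - C (1 / 2) * derivative (derivative φ)) * C (moment u 0) =
      C ((ψ.coeff 1 - φ.coeff 2) * moment u 0) := by
    rw [hdφ]
    conv_lhs => rw [hψe]
    simp only [derivative_add, derivative_mul, derivative_C, derivative_X, zero_mul, zero_add,
      add_zero, mul_one]
    rw [← C_mul, ← C_sub, ← C_mul]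
    congr 1
    ring
  have hconst : polyInZ (C ((ψ.coeff 1 - φ.coeff 2) * moment u 0)) =
      HahnSeries.single (0 : ℤ) ((ψ.coeff 1 - φ.coeff 2) * moment u 0) := by
    rw [polyInZ, eval₂_C, HahnSeries.C_apply]
  rw [hc, hconst, HahnSeries.ext_iff, funext_iff]
  have e1 : (ψ - derivative φ).coeff 1 = ψ.coeff 1 - 2 * φ.coeff 2 := by
    rw [hχ]; simp
  have e0 : (ψ - derivative φ).coeff 0 = ψ.coeff 0 - φ.coeff 1 := by
    rw [hχ]; simp
  have e2 : (ψ - derivative φ).coeff 2 = 0 := by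
    rw [hχ]; simp
  simp only [HahnSeries.coeff_add, coeff_polyInZ_mul hφ, coeff_polyInZ_mul hχ2, coeff_zDeriv,
    e0, e1, e2]
  have main : ∀ n : ℕ,
      φ.coeff 2 * -((((n + 1 : ℤ) + 2 : ℤ) - 1) * (stieltjes u).coeff ((n + 1 : ℤ) + 2 - 1))
      + φ.coeff 1 * -((((n + 1 : ℤ) + 1 : ℤ) - 1) * (stieltjes u).coeff ((n + 1 : ℤ) + 1 - 1))
      + φ.coeff 0 * -(((n + 1 : ℤ) - 1) * (stieltjes u).coeff ((n + 1 : ℤ) - 1))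
      - (0 * (stieltjes u).coeff ((n + 1 : ℤ) + 2)
      + (ψ.coeff 1 - 2 * φ.coeff 2) * (stieltjes u).coeff ((n + 1 : ℤ) + 1)
      + (ψ.coeff 0 - φ.coeff 1) * (stieltjes u).coeff (n + 1 : ℤ)) =
      dCoef φ ψ n * moment u (n + 1) + eCoef φ ψ n * moment u n
      + n * φ.coeff 0 * moment u (n - 1) := by
    intro n
    have s1 : (stieltjes u).coeff ((n + 1 : ℤ) + 1) = -moment u (n + 1) := by
      exact_mod_cast coeff_stieltjes_succ u (n + 1)
    -- The factor `n` is kept so that the truncated index `n - 1` is harmless at `n = 0`.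
    have s2 : (n : ℂ) * (stieltjes u).coeff n = -(n * moment u (n - 1)) := by
      rcases n with _ | n
      · simp
      · push_cast
        rw [coeff_stieltjes_succ]
        simp
    rw [show ((n + 1 : ℤ) + 2 - 1) = (n + 1 : ℤ) + 1 by ring, add_sub_cancel_right,
      add_sub_cancel_right, s1, coeff_stieltjes_succ]
    simp only [dCoef, eCoef]
    push_cast
    linear_combination -φ.coeff 0 * s2
  constructor
  · intro h n
    have h1 := h (n + 1)
    rw [HahnSeries.coeff_single_of_ne (by omega), add_zero] at h1
    exact (main n).symm.trans (sub_eq_zero.2 h1)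
  · intro h k
    rcases lt_or_ge 0 k with hk | hk
    · obtain ⟨n, rfl⟩ : ∃ n : ℕ, k = n + 1 := ⟨(k - 1).toNat, by omega⟩
      rw [HahnSeries.coeff_single_of_ne (by omega), add_zero]
      exact sub_eq_zero.1 ((main n).trans (h n))
    · rcases hk.eq_or_lt with rfl | hk
      -- At exponent zero the constant term `(ψ' - φ''/2) u_0` is exactly what balances the two
      -- sides.
      · have s1 := coeff_stieltjes_succ u 0
        rw [Nat.cast_zero, zero_add] at s1
        rw [HahnSeries.coeff_single_same, show (0 : ℤ) + 2 - 1 = 1 by ring, zero_add (1 : ℤ), s1,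
          coeff_stieltjes_of_nonpos u (k := 1 - 1) (by omega),
          coeff_stieltjes_of_nonpos u (k := 0 - 1) (by omega),
          coeff_stieltjes_of_nonpos u (k := 0) (by omega)]
        push_cast
        ring
      · rw [HahnSeries.coeff_single_of_ne (by omega),
          coeff_stieltjes_of_nonpos u (k := k + 2 - 1) (by omega),
          coeff_stieltjes_of_nonpos u (k := k + 1 - 1) (by omega),
          coeff_stieltjes_of_nonpos u (k := k - 1) (by omega),
          coeff_stieltjes_of_nonpos u (k := k + 1) (by omega),
          coeff_stieltjes_of_nonpos u (k := k) (by omega)]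
        ring

/-! ### From orthogonal derivatives to the relation between consecutive orders -/

lemma iterate_derivative_linear_mul (β : ℂ) (q : ℂ[X]) (k : ℕ) :
    derivative^[k + 1] ((X - C β) * q) =
      (X - C β) * derivative^[k + 1] q + C (k + 1 : ℂ) * derivative^[k] q := by
  induction k with
  | zero => simp; ring
  | succ k ih =>
    rw [Function.iterate_succ_apply', ih, derivative_add, derivative_mul, derivative_C_mul,
      ← Function.iterate_succ_apply' (f := derivative),
      ← Function.iterate_succ_apply' (f := derivative)]
    simp only [derivative_sub, derivative_X, derivative_C]
    push_cast
    simp only [C_add, C_1]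
    simp only [Nat.succ_eq_add_one]
    ring

/-- Differentiating the recurrence of `P` produces one term of lower derivative order, from Leibniz'
rule on `x P_n`. The remaining product with `x` is eliminated by the recurrence of the derivative
sequence itself. -/
lemma c4At_of_c3At (hP : IsMonicOPS u P) {k : ℕ} (hk : 1 ≤ k) (h : C3At P k) : C4At P k := by
  obtain ⟨v, hv⟩ := h
  obtain ⟨k, rfl⟩ : ∃ j, k = j + 1 := ⟨k - 1, by omega⟩
  suffices H : ∀ n, ∃ r s : ℂ, 2 ≤ n → DerivEq P (k + 1) n r s by
    choose r s hrs using H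
    exact ⟨r, s, fun n hn => hrs n hn⟩
  intro n
  rcases lt_or_ge n 2 with hn | hn
  · exact ⟨0, 0, fun h => absurd h (by omega)⟩
  obtain ⟨n, rfl⟩ : ∃ j, n = j + 2 := ⟨n - 2, by omega⟩
  have t1 := congrArg derivative^[k + 1] (hP.ttrr.2 (n + k + 2))
  have t2 := hv.ttrr.2 (n + 1)
  set β := recBeta u P (n + k + 2)
  set γ := recGamma u P (n + k + 2)
  set β' := recBeta v (normDeriv P (k + 1)) (n + 1)
  set γ' := recGamma v (normDeriv P (k + 1)) (n + 1)
  rw [prev] at t1 t2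
  rw [iterate_derivative_sub, iterate_derivative_linear_mul, iterate_derivative_C_mul,
    show n + k + 2 + 1 = (n + 2) + (k + 1) by ring, iterate_derivative_eq,
    show P (n + k + 2) = P ((n + 1) + (k + 1)) by ring_nf, iterate_derivative_eq,
    show P (n + 1 + (k + 1)) = P ((n + 2) + k) by ring_nf, iterate_derivative_eq,
    show P (n + k + 1) = P (n + (k + 1)) by ring_nf, iterate_derivative_eq] at t1
  set A := (n + 2 + 1).ascFactorial k
  have f1 : (((n + 2 + 1).ascFactorial (k + 1) : ℕ) : ℂ) = (n + k + 3) * A := by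
    rw [Nat.ascFactorial_succ]
    push_cast
    ring
  have f2 : (((n + 1 + 1).ascFactorial (k + 1) : ℕ) : ℂ) = (n + 2) * A := by
    rw [Nat.ascFactorial_succ, ← Nat.succ_ascFactorial, Nat.cast_mul]
    push_cast
    ring
  have hA : (A : ℂ) ≠ 0 := ascFactorial_cast_ne_zero _ _
  have hk0 : (k : ℂ) + 1 ≠ 0 := by exact_mod_cast Nat.succ_ne_zero k
  set B : ℂ := (((n + 1).ascFactorial (k + 1) : ℕ) : ℂ)
  rw [f1, f2] at t1
  have hKA : ((k : ℂ) + 1) * A ≠ 0 := mul_ne_zero hk0 hA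
  refine ⟨(((k : ℂ) + 1) * A)⁻¹ * ((n + 2) * A * (β - β')),
    (((k : ℂ) + 1) * A)⁻¹ * (γ * B - (n + 2) * A * γ'), fun _ => ?_⟩
  have hinv : (C (((k : ℂ) + 1) * A)⁻¹ : ℂ[X]) * C (((k : ℂ) + 1) * A) = 1 := by
    rw [← C_mul, inv_mul_cancel₀ hKA, C_1]
  rw [DerivEq, Nat.add_sub_cancel, show n + 2 - 1 = n + 1 by omega, Nat.add_sub_cancel]
  have hc : (C (((n : ℂ) + k + 3) * A) : ℂ[X]) =
      C (((n : ℂ) + 2) * A) + C (((k : ℂ) + 1) * A) := by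
    rw [← C_add]
    congr 1
    ring
  rw [hc] at t1
  have key : C (((k : ℂ) + 1) * A) * normDeriv P k (n + 2) =
      C (((k : ℂ) + 1) * A) * normDeriv P (k + 1) (n + 2)
      + C ((n + 2) * A * (β - β')) * normDeriv P (k + 1) (n + 1)
      + C (γ * B - (n + 2) * A * γ') * normDeriv P (k + 1) n := by
    rw [C_mul (a := (n + 2) * (A : ℂ)), C_sub, C_sub, C_mul (a := γ),
      C_mul (a := (n + 2) * (A : ℂ)) (b := γ'), C_mul (a := (k : ℂ) + 1)]
    rw [C_mul (a := (k : ℂ) + 1)] at t1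
    linear_combination -t1 + C ((n + 2) * (A : ℂ)) * t2
  rw [C_mul (b := (n + 2) * (A : ℂ) * (β - β')), C_mul (b := γ * B - (n + 2) * A * γ')]
  linear_combination C (((k : ℂ) + 1) * A)⁻¹ * key
    + (normDeriv P (k + 1) (n + 2) - normDeriv P k (n + 2)) * hinv

lemma derivative_P_succ (P : ℕ → ℂ[X]) (n : ℕ) :
    derivative (P (n + 1)) = C (n + 1 : ℂ) * normDeriv P 1 n := by
  have h1 := iterate_derivative_eq P 1 n
  rw [Function.iterate_one, Nat.ascFactorial_succ, Nat.ascFactorial_zero] at h1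
  rw [h1]
  push_cast
  rw [add_zero, mul_one]

lemma apply_mul_derivative_self (hP : IsMonicOPS u P) (h : C1At u φ ψ) (n : ℕ) :
    u (φ * derivative (P n) * derivative (P n)) =
      -(n * dCoef φ ψ (n - 1) * u (P n * P n)) := by
  have := bochner_symm h.2.2.2.2 (P n) (P n)
  rw [bochner_eq hP h.2.1 h.2.2.2.1 h.2.2.2.2, mul_assoc, map_C_mul] at this
  linear_combination this

/-- The relation is paired under `φ u` with `P_{j+1}'`, a multiple of `P_j^{[1]}`: orthogonality
isolates `r` at `j = n + 1` and `s` at `j = n`, while the left side is known from the structure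
relation. -/
lemma derivEq_params (hP : IsMonicOPS u P) (h : C1At u φ ψ) {n : ℕ} {r s : ℂ}
    (hrs : DerivEq P 1 (n + 2) r s) :
    r = (1 / 2) * (ψ.eval (recBeta u P (n + 2)) / dCoef φ ψ (n + 1)) ∧
      s = -(((n + 1) * φ.coeff 2 / dCoef φ ψ n) * recGamma u P (n + 2)) := by
  have hQ := isMonicOPS_normDeriv hP h 1
  rw [pow_one] at hQ
  rw [DerivEq, Nat.sub_self, normDeriv_zero, show n + 2 - 1 = n + 1 by omega,
    Nat.add_sub_cancel] at hrs
  have horth : ∀ {i j : ℕ}, i ≠ j → u (φ * (normDeriv P 1 i * normDeriv P 1 j)) = 0 :=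
    fun hij => hQ.apply_mul_of_ne hij
  have hpair : ∀ j, u (φ * derivative (P (j + 1)) * P (n + 2)) =
      (j + 1) * (u (φ * (normDeriv P 1 (n + 2) * normDeriv P 1 j))
        + r * u (φ * (normDeriv P 1 (n + 1) * normDeriv P 1 j))
        + s * u (φ * (normDeriv P 1 n * normDeriv P 1 j))) := by
    intro j
    conv_lhs => rw [hrs]
    rw [derivative_P_succ, ← map_C_mul, ← map_C_mul, ← map_add, ← map_add, ← map_C_mul]
    congr 1
    ring
  have hself : ∀ j : ℕ, (j + 1) * u (φ * (normDeriv P 1 j * normDeriv P 1 j)) =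
      -(dCoef φ ψ j * u (P (j + 1) * P (j + 1))) := by
    intro j
    have h1 := apply_mul_derivative_self hP h (j + 1)
    have h2 : φ * derivative (P (j + 1)) * derivative (P (j + 1)) =
        C (j + 1 : ℂ) * (C (j + 1 : ℂ) * (φ * (normDeriv P 1 j * normDeriv P 1 j))) := by
      rw [derivative_P_succ]
      ring
    rw [h2, map_C_mul, map_C_mul] at h1
    push_cast at h1
    rw [add_sub_cancel_right] at h1
    have hj : (j : ℂ) + 1 ≠ 0 := by exact_mod_cast Nat.succ_ne_zero j
    refine mul_left_cancel₀ hj ?_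
    rw [h1]
    ring
  have d1 : dCoef φ ψ (n + 1) ≠ 0 := dCoef_ne_zero hP h (by omega)
  have d0 : dCoef φ ψ n ≠ 0 := dCoef_ne_zero hP h (by omega)
  have hn2 := hP.norm_ne_zero (n + 2)
  have hn1 := hP.norm_ne_zero (n + 1)
  constructor
  · have h1 := hpair (n + 1)
    have h2 := hself (n + 1)
    rw [horth (i := n + 2) (by omega), horth (i := n) (by omega),
      apply_structure_self hP h (n + 2)] at h1
    push_cast at h1 h2
    rw [mul_div_assoc', eq_div_iff d1]
    refine mul_right_cancel₀ hn2 ?_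
    linear_combination h1 + r * h2
  · have h1 := hpair n
    have h2 := hself n
    rw [horth (i := n + 2) (by omega), horth (i := n + 1) (by omega),
      apply_structure_succ hP h.2.1 (n + 1), hP.norm_succ (n + 1)] at h1
    push_cast at h1 h2
    rw [div_mul_eq_mul_div, neg_div', eq_div_iff d0]
    refine mul_right_cancel₀ hn1 ?_
    linear_combination h1 + s * h2

lemma derivEq_iff (hP : IsMonicOPS u P) (h : C1At u φ ψ) {n : ℕ} (hn : 2 ≤ n) (r s : ℂ) :
    DerivEq P 1 n r s ↔
      r = (1 / 2) * (ψ.eval (recBeta u P n) / dCoef φ ψ (n - 1)) ∧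
        s = -(((n - 1) * φ.coeff 2 / dCoef φ ψ (n - 2)) * recGamma u P n) := by
  obtain ⟨n, rfl⟩ : ∃ j, n = j + 2 := ⟨n - 2, by omega⟩
  have i1 : ((n + 2 : ℕ) : ℤ) - 1 = n + 1 := by push_cast; ring
  have i2 : ((n + 2 : ℕ) : ℤ) - 2 = n := by push_cast; ring
  have i3 : ((n + 2 : ℕ) : ℂ) - 1 = n + 1 := by push_cast; ring
  rw [i1, i2, i3]
  refine ⟨derivEq_params hP h, ?_⟩
  rintro ⟨rfl, rfl⟩
  -- Some coefficients exist, and `derivEq_params` forces them to be the stated ones.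
  obtain ⟨r, s, hrs⟩ := c4At_of_c3At hP le_rfl (c3At_of_c1At hP h 1)
  have h1 := hrs (n + 2) hn
  obtain ⟨e1, e2⟩ := derivEq_params hP h h1
  rwa [e1, e2] at h1

/-! ### From the relation between consecutive orders back to Pearson's equation -/

lemma degree_lt_of_iterate_derivative_eq_zero {q : ℂ[X]} {k : ℕ} (h : derivative^[k] q = 0) :
    q.degree < k := by
  rw [degree_lt_iff_coeff_zero]
  intro m hm
  obtain ⟨m, rfl⟩ : ∃ j, m = j + k := ⟨m - k, by omega⟩
  have h1 := congrArg (fun p => coeff p m) h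
  simp only [coeff_iterate_derivative, coeff_zero, nsmul_eq_mul, mul_eq_zero, Nat.cast_eq_zero,
    Nat.descFactorial_eq_zero_iff_lt] at h1
  exact h1.resolve_left (by omega)

/-- A weak form of `C4At`: up to a polynomial of low degree, `P j` is a combination of the
derivatives of three consecutive terms. -/
lemma exists_degree_sub_derivative_lt {k : ℕ} (h : C4At P (k + 1)) {j : ℕ} (hj : k + 2 ≤ j) :
    ∃ a b c d : ℂ, a ≠ 0 ∧
      (C a * P j - derivative (C b * P (j + 1) + C c * P j + C d * P (j - 1))).degree < k := by
  obtain ⟨r, s, h⟩ := h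
  obtain ⟨n, rfl⟩ : ∃ n, j = n + 2 + k := ⟨j - 2 - k, by omega⟩
  have h1 := h (n + 2) (by omega)
  rw [DerivEq, Nat.add_sub_cancel, show n + 2 - 1 = n + 1 by omega, Nat.add_sub_cancel] at h1
  simp only [normDeriv, smul_eq_C_mul] at h1
  rw [show n + 2 + (k + 1) = n + 2 + k + 1 by ring, show n + 1 + (k + 1) = n + 2 + k by ring,
    show n + (k + 1) = n + 2 + k - 1 by omega] at h1
  set a : ℂ := (((n + 2 + 1).ascFactorial k : ℕ) : ℂ)⁻¹
  set b : ℂ := (((n + 2 + 1).ascFactorial (k + 1) : ℕ) : ℂ)⁻¹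
  set c : ℂ := (((n + 1 + 1).ascFactorial (k + 1) : ℕ) : ℂ)⁻¹
  set d : ℂ := (((n + 1).ascFactorial (k + 1) : ℕ) : ℂ)⁻¹
  refine ⟨a, b, r (n + 2) * c, s (n + 2) * d, inv_ne_zero (ascFactorial_cast_ne_zero _ _),
    degree_lt_of_iterate_derivative_eq_zero ?_⟩
  rw [iterate_derivative_sub, ← Function.iterate_succ_apply (f := derivative),
    iterate_map_add, iterate_map_add, iterate_derivative_C_mul,
    iterate_derivative_C_mul, iterate_derivative_C_mul, iterate_derivative_C_mul, C_mul, C_mul]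
  linear_combination h1

lemma exists_linear_antiderivative :
    ∃ I : ℂ[X] →ₗ[ℂ] ℂ[X], ∀ p, derivative (I p) = p := by
  obtain ⟨I, hI⟩ := (derivative (R := ℂ)).exists_rightInverse_of_surjective
    (LinearMap.range_eq_top.2 derivative_surjective)
  exact ⟨I, fun p => LinearMap.congr_fun hI p⟩

/-- The functional `f u` is an antiderivative of `-P_{m+1} u`. The last clause, saying that it sees
only the coefficient of `x^m` up to degree `m`, drives the degree descent in `c1At_of_c4At`. -/
lemma exists_pearson_of_c4At (hP : IsMonicOPS u P) {k : ℕ} (h : C4At P (k + 1)) {m : ℕ}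
    (hm : k ≤ m) : ∃ f : ℂ[X], f.degree < (m + 3 : ℕ) ∧ Pearson u f (-P (m + 1)) ∧
      ∀ q : ℂ[X], q.degree < (m + 1 : ℕ) →
        (m + 1) * u (f * q) = q.coeff m * u (P (m + 1) * P (m + 1)) := by
  obtain ⟨I, hI⟩ := exists_linear_antiderivative
  let w : Module.Dual ℂ ℂ[X] := u ∘ₗ LinearMap.mulRight ℂ (P (m + 1)) ∘ₗ I
  -- The constant of integration is invisible because `u (P (m + 1)) = 0`.
  have hwd : ∀ p, w (derivative p) = u (p * P (m + 1)) := by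
    intro p
    have h1 : derivative (I (derivative p) - p) = 0 := by
      rw [derivative_sub, hI, sub_self]
    have h2 := eq_C_of_derivative_eq_zero h1
    have h3 : u ((I (derivative p) - p) * P (m + 1)) = 0 := by
      rw [h2, map_C_mul, hP.apply_eq_zero (by omega), mul_zero]
    rw [sub_mul, map_sub] at h3
    exact sub_eq_zero.1 h3
  have hwq : ∀ q : ℂ[X], q.degree < (m + 1 : ℕ) →
      (m + 1) * w q = q.coeff m * u (P (m + 1) * P (m + 1)) := by
    intro q hq
    have h1 : ∀ n, q.coeff n = (I q).coeff (n + 1) * (n + 1) := by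
      intro n
      rw [← coeff_derivative, hI]
    have h2 : (I q).degree < (m + 1 + 1 : ℕ) := by
      rw [degree_lt_iff_coeff_zero] at hq ⊢
      intro n hn
      obtain ⟨n, rfl⟩ : ∃ j, n = j + 1 := ⟨n - 1, by omega⟩
      have h3 := h1 n
      rw [hq n (by omega), eq_comm, mul_eq_zero] at h3
      exact h3.resolve_right (by exact_mod_cast Nat.succ_ne_zero n)
    have h4 : w q = u (I q * P (m + 1)) := rfl
    rw [h4, hP.apply_mul h2, h1 m]
    ring
  obtain ⟨f, hf, hw⟩ := hP.exists_eq_leftMul (v := w) (N := m + 3) fun j hj => by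
    -- Up to an error of degree below `k ≤ m`, which `w` kills, `P_j` is a derivative of a
    -- combination of `P_{j+1}`, `P_j`, `P_{j-1}`. These are orthogonal to `P_{m+1}` as soon as `j -
    -- 1 > m + 1`.
    obtain ⟨a, b, c, d, ha, hd⟩ := exists_degree_sub_derivative_lt h (j := j) (by omega)
    have h1 := hwq _ (hd.trans (by exact_mod_cast (by omega : k < m + 1)))
    rw [coeff_eq_zero_of_degree_lt (hd.trans_le (by exact_mod_cast hm)), zero_mul, mul_eq_zero]
      at h1
    have h2 := h1.resolve_left (by exact_mod_cast Nat.succ_ne_zero m)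
    rw [map_sub, hwd, map_C_mul, add_mul, add_mul, map_add, map_add, mul_assoc, mul_assoc,
      mul_assoc, map_C_mul, map_C_mul, map_C_mul, hP.apply_mul_of_ne (m := j + 1) (by omega),
      hP.apply_mul_of_ne (m := j) (by omega), hP.apply_mul_of_ne (m := j - 1) (by omega)] at h2
    simpa [ha] using h2
  refine ⟨f, hf, ?_, fun q hq => ?_⟩
  · rw [pearson_iff]
    intro q
    have h1 := hwd q
    rw [hw, leftMul_apply] at h1
    rw [map_add, h1, ← map_add]
    rw [show q * P (m + 1) + -P (m + 1) * q = 0 by ring, map_zero]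
  · rw [← hwq q hq, hw, leftMul_apply]

lemma Pearson.mul_left (h : Pearson u φ ψ) (f : ℂ[X]) :
    Pearson u (f * φ) (derivative f * φ + f * ψ) := by
  rw [pearson_iff] at *
  intro q
  rw [← h (f * q), derivative_mul]
  congr 1
  ring

/-- The polynomials `φ` such that `D (φ u)` is a polynomial multiple of `u`. -/
def pearsonIdeal (u : Module.Dual ℂ ℂ[X]) : Ideal ℂ[X] where
  carrier := {φ | ∃ ψ, Pearson u φ ψ}
  zero_mem' := ⟨0, by rw [pearson_iff]; simp⟩
  add_mem' := by
    rintro φ₁ φ₂ ⟨ψ₁, h₁⟩ ⟨ψ₂, h₂⟩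
    refine ⟨ψ₁ + ψ₂, ?_⟩
    rw [pearson_iff] at *
    intro q
    have h := congrArg₂ (· + ·) (h₁ q) (h₂ q)
    simp only [← map_add, add_zero] at h
    rw [← h]
    congr 1
    ring
  smul_mem' := by
    rintro f φ ⟨ψ, h⟩
    exact ⟨_, h.mul_left f⟩

lemma Pearson.unique (hP : IsMonicOPS u P) {ψ' : ℂ[X]} (h : Pearson u φ ψ) (h' : Pearson u φ ψ') :
    ψ = ψ' :=
  hP.leftMul_injective (h.symm.trans h')

/-- If `deg φ ≥ 3`, the bound on `f φ` suffices. Otherwise `deg ψ ≥ 2`, and `f ψ` dominates `f' φ`,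
so `deg f + deg ψ = m`. -/
lemma natDegree_cofactor_le {f p : ℂ[X]} {m : ℕ} (hf0 : f ≠ 0) (hp : p.natDegree = m)
    (hd : (f * φ).degree < (m + 2 : ℕ)) (hφ0 : φ ≠ 0)
    (hfp : derivative f * φ + f * ψ = p)
    (hbad : 3 ≤ φ.natDegree ∨ 2 ≤ ψ.natDegree) : f.natDegree + 2 ≤ m := by
  have h1 : f.natDegree + φ.natDegree < m + 2 := by
    rw [← natDegree_mul hf0 hφ0]
    exact (natDegree_lt_iff_degree_lt (mul_ne_zero hf0 hφ0)).2 hd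
  by_cases h3 : 3 ≤ φ.natDegree
  · omega
  · have h2 := hbad.resolve_left h3
    have hψ0 : ψ ≠ 0 := by
      rintro rfl
      simp at h2
    have h4 : (f * ψ).natDegree = f.natDegree + ψ.natDegree := natDegree_mul hf0 hψ0
    have h5 : (derivative f * φ).natDegree < (f * ψ).natDegree := by
      rw [h4]
      rcases Nat.eq_zero_or_pos f.natDegree with h0 | h0
      · rw [derivative_eq_zero.2 h0, zero_mul, natDegree_zero]
        omega
      · have := natDegree_mul_le (p := derivative f) (q := φ)
        have := natDegree_derivative_lt (p := f) h0.ne'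
        omega
    rw [← hp, ← hfp, natDegree_add_eq_right_of_natDegree_lt h5, h4]
    omega

/-- Were `deg f ≤ deg g`, the value of `w` on `f g x^(m - deg g)` would be computed in two ways:
nonzero when `g x^(m - deg g)`, of degree exactly `m`, is paired with `f`, and zero when `f x^(m -
deg g)`, of degree below `m + 1`, is paired with `g`. -/
lemma natDegree_lt_of_pairing {w : Module.Dual ℂ ℂ[X]} {f g : ℂ[X]} {m : ℕ} (hg0 : g ≠ 0)
    (hg : g.natDegree ≤ m) {a b : ℂ} (ha : a ≠ 0)
    (hf : ∀ q : ℂ[X], q.degree < (m + 1 : ℕ) → (m + 1) * w (f * q) = q.coeff m * a)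
    (hg' : ∀ q : ℂ[X], q.degree < (m + 2 : ℕ) →
      (m + 1 + 1 : ℂ) * w (g * q) = q.coeff (m + 1) * b) :
    g.natDegree < f.natDegree := by
  by_contra! hle
  have hdeg : ∀ p : ℂ[X], p.natDegree ≤ g.natDegree →
      (p * X ^ (m - g.natDegree)).degree < ((m + 1 : ℕ) : WithBot ℕ) := by
    intro p hp
    refine lt_of_le_of_lt degree_le_natDegree ?_
    have := natDegree_mul_le (p := p) (q := X ^ (m - g.natDegree))
    rw [natDegree_X_pow] at this
    exact_mod_cast (by omega : (p * X ^ (m - g.natDegree)).natDegree < m + 1)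
  have h1 := hf _ (hdeg g le_rfl)
  have h2 := hg' _ ((hdeg f hle).trans (Nat.cast_lt.2 (Nat.lt_succ_self (m + 1))))
  rw [coeff_eq_zero_of_degree_lt (hdeg f hle), zero_mul, mul_eq_zero] at h2
  have h3 := h2.resolve_left (by exact_mod_cast Nat.succ_ne_zero (m + 1))
  rw [show g * (f * X ^ (m - g.natDegree)) = f * (g * X ^ (m - g.natDegree)) by ring] at h3
  have h4 : (g * X ^ (m - g.natDegree)).coeff m = g.leadingCoeff := by
    conv_lhs => rw [← Nat.add_sub_cancel' hg]
    rw [show m = g.natDegree + (m - g.natDegree) by omega]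
    simp [coeff_mul_X_pow]
  rw [h3, mul_zero, h4, eq_comm, mul_eq_zero] at h1
  exact h1.elim (leadingCoeff_ne_zero.2 hg0) ha

lemma c1At_of_c4At (hP : IsMonicOPS u P) {k : ℕ} (hk : 1 ≤ k) (h : C4At P k) :
    ∃ φ ψ, C1At u φ ψ := by
  obtain ⟨k, rfl⟩ : ∃ j, k = j + 1 := ⟨k - 1, by omega⟩
  obtain ⟨φ, hφ⟩ := (IsPrincipalIdealRing.principal (pearsonIdeal u)).principal
  obtain ⟨ψ, hψ⟩ : φ ∈ pearsonIdeal u := by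
    rw [hφ]
    exact Submodule.mem_span_singleton_self φ
  choose F hFd hFp hFq using fun i : ℕ =>
    exists_pearson_of_c4At hP h (m := k + i) (Nat.le_add_right k i)
  have hF0 : ∀ i, F i ≠ 0 := by
    intro i h0
    have h1 := hFq i (X ^ (k + i)) (by
      rw [degree_X_pow]
      exact_mod_cast Nat.lt_succ_self (k + i))
    rw [h0, zero_mul, map_zero, mul_zero, coeff_X_pow_self, one_mul] at h1
    exact hP.norm_ne_zero _ h1.symm
  have hdvd : ∀ i, ∃ f, F i = f * φ := by
    intro i
    have h1 : F i ∈ pearsonIdeal u := ⟨_, hFp i⟩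
    rw [hφ] at h1
    obtain ⟨f, hf⟩ := Submodule.mem_span_singleton.1 h1
    exact ⟨f, hf.symm⟩
  choose f hf using hdvd
  have hφ0 : φ ≠ 0 := by
    rintro rfl
    exact hF0 0 (by rw [hf, mul_zero])
  have hf0 : ∀ i, f i ≠ 0 := by
    intro i h0
    exact hF0 i (by rw [hf, h0, zero_mul])
  -- If a degree is too large, the cofactors `f i` satisfy both preceding degree lemmas, the second
  -- with respect to `φ u`, so their degrees descend indefinitely.
  have hgood : ¬(3 ≤ φ.natDegree ∨ 2 ≤ ψ.natDegree) := by
    intro hbad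
    have hle : ∀ i, (f i).natDegree + 2 ≤ k + i + 1 := by
      intro i
      refine natDegree_cofactor_le (p := -P (k + i + 1)) (φ := φ) (ψ := ψ) (hf0 i) ?_ ?_ hφ0 ?_ hbad
      · rw [natDegree_neg, hP.natDegree_eq]
      · rw [← hf]
        exact hFd i
      · have h1 := hFp i
        rw [hf] at h1
        exact (hψ.mul_left (f i)).unique hP h1
    have hlt : ∀ i, (f (i + 1)).natDegree < (f i).natDegree := by
      intro i
      refine natDegree_lt_of_pairing (w := leftMul φ u) (m := k + i) (hf0 (i + 1))
        (by have := hle (i + 1); omega) (hP.norm_ne_zero (k + i + 1)) (fun q hq => ?_)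
        (b := u (P (k + i + 2) * P (k + i + 2))) (fun q hq => ?_)
      · rw [leftMul_apply, ← mul_assoc, mul_comm φ, ← hf]
        exact hFq i q hq
      · rw [leftMul_apply, ← mul_assoc, mul_comm φ, ← hf]
        exact_mod_cast hFq (i + 1) q hq
    have hsum : ∀ i, (f i).natDegree + i ≤ (f 0).natDegree := by
      intro i
      induction i with
      | zero => simp
      | succ i ih =>
        have := hlt i
        omega
    have := hsum ((f 0).natDegree + 1)
    omega
  exact ⟨φ, ψ, hφ0, by omega, hψ.psi_ne_zero hP hφ0, by omega, hψ⟩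

end ClassicalOPS

/-! ### Assembly of the equivalences and parameters -/

theorem mainTheorem10 (u : Module.Dual ℂ ℂ[X]) (P : ℕ → ℂ[X])
    (hu : IsRegular u) (hP : IsMonicOPS u P) :
    -- the equivalence of C1, C1', C2, C3, C3', C4, C4', C5, C6, C7, C8
    List.TFAE [
      ∃ φ ψ : ℂ[X], C1At u φ ψ,
      ∃ φ ψ : ℂ[X], C1At' u φ ψ,
      ∃ φ : ℂ[X], C2At P φ,
      ∃ k : ℕ, 1 ≤ k ∧ C3At P k,
      ∀ k : ℕ, 1 ≤ k → C3At P k,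
      ∃ k : ℕ, 1 ≤ k ∧ C4At P k,
      ∀ k : ℕ, 1 ≤ k → C4At P k,
      ∃ φ ψ : ℂ[X], C5At P φ ψ,
      ∃ φ ψ : ℂ[X], C6At u φ ψ,
      ∃ φ ψ : ℂ[X], C7At P φ ψ,
      ∃ φ : ℂ[X], C8At u P φ] ∧
    -- the polynomials are the same in all the properties in which they appear
    (∀ φ ψ : ℂ[X], List.TFAE [
      C1At u φ ψ, C1At' u φ ψ, C5At P φ ψ, C6At u φ ψ, C7At P φ ψ]) ∧
    (∀ φ : ℂ[X], List.TFAE [∃ ψ : ℂ[X], C1At u φ ψ, C2At P φ, C8At u P φ]) ∧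
    -- the explicit parameters
    ∃ β γ : ℕ → ℂ, TTRR P β γ ∧ (∀ n, 1 ≤ n → γ n ≠ 0) ∧
      ∀ φ ψ : ℂ[X], C1At u φ ψ →
        β 0 = -(eCoef φ ψ 0 / dCoef φ ψ 0) ∧
        (∀ n : ℕ, 1 ≤ n →
          β n = -((dCoef φ ψ (-2) * ψ.coeff 0 + 2 * φ.coeff 1 * n * dCoef φ ψ (n - 1)) /
            (dCoef φ ψ (2 * n) * dCoef φ ψ (2 * n - 2)))) ∧
        γ 1 = -(1 / dCoef φ ψ 1) * φ.eval (-(eCoef φ ψ 0 / dCoef φ ψ 0)) ∧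
        (∀ n : ℕ, 2 ≤ n →
          γ n = -((n * dCoef φ ψ (n - 2)) / (dCoef φ ψ (2 * n - 3) * dCoef φ ψ (2 * n - 1))) *
            φ.eval (-(eCoef φ ψ (n - 1) / dCoef φ ψ (2 * n - 2)))) ∧
        (∀ (n : ℕ) (a b c : ℂ), StructureEq P φ n a b c ↔
          a = n * φ.coeff 2 ∧ b = -(1 / 2) * ψ.eval (β n) ∧
            (1 ≤ n → c = -(dCoef φ ψ (n - 1) * γ n))) ∧
        (∀ (n : ℕ) (r s : ℂ), 2 ≤ n → (DerivEq P 1 n r s ↔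
          r = (1 / 2) * (ψ.eval (β n) / dCoef φ ψ (n - 1)) ∧
            s = -(((n - 1) * φ.coeff 2 / dCoef φ ψ (n - 2)) * γ n))) ∧
        (∀ (n : ℕ) (l : ℂ), BochnerEq P φ ψ n l ↔ l = -(n * dCoef φ ψ (n - 1))) ∧
        (∀ (n : ℕ) (h t : ℂ), 1 ≤ n → (McCarthyEq P φ ψ n h t ↔
          h = dCoef φ ψ (2 * n - 3) ∧ t = -(dCoef φ ψ (2 * n - 1) * γ n))) ∧
        (∀ (n : ℕ) (κ : ℂ), RodriguesEq u P φ n κ ↔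
          κ = ∏ i ∈ Finset.range n, (dCoef φ ψ (n + i - 1))⁻¹) := by
  have t₂ : ∀ φ ψ : ℂ[X], List.TFAE [
      C1At u φ ψ, C1At' u φ ψ, C5At P φ ψ, C6At u φ ψ, C7At P φ ψ] := by
    intro φ ψ
    tfae_have 1 ↔ 2 := c1At_iff_c1At' hP
    tfae_have 1 → 3 := c5At_of_c1At hP
    tfae_have 3 → 1 := c1At_of_c5At hP
    tfae_have 4 ↔ 2 := c6At_iff_c1At'
    tfae_have 1 → 5 := c7At_of_c1At hP
    tfae_have 5 → 1 := c1At_of_c7At hP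
    tfae_finish
  have t₃ : ∀ φ : ℂ[X], List.TFAE [∃ ψ : ℂ[X], C1At u φ ψ, C2At P φ, C8At u P φ] := by
    intro φ
    tfae_have 1 → 2 := fun ⟨_, h⟩ => c2At_of_c1At hP h
    tfae_have 2 → 1 := c1At_of_c2At hP
    tfae_have 1 → 3 := fun ⟨_, h⟩ => c8At_of_c1At hP h
    tfae_have 3 → 1 := c1At_of_c8At hP
    tfae_finish
  refine ⟨?_, t₂, t₃, recBeta u P, recGamma u P, hP.ttrr, fun n _ => hP.recGamma_ne_zero n,
    fun φ ψ h => ⟨recBeta_zero_eq hP h, fun n hn => recBeta_eq hP h hn, recGamma_one_eq hP h,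
      fun n hn => recGamma_eq hP h hn, structureEq_iff hP h, fun n r s hn => derivEq_iff hP h hn r s,
      bochnerEq_iff hP h, fun n k t hn => mcCarthyEq_iff hP h hn k t, rodriguesEq_iff hP h⟩⟩
  tfae_have 1 ↔ 2 := exists_congr fun φ => exists_congr fun ψ => (t₂ φ ψ).out 0 1
  tfae_have 1 ↔ 3 := exists_congr fun φ => (t₃ φ).out 0 1
  tfae_have 1 → 5 := fun ⟨_, _, h⟩ k _ => c3At_of_c1At hP h k
  tfae_have 5 → 4 := fun h => ⟨1, le_rfl, h 1 le_rfl⟩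
  tfae_have 5 → 7 := fun h k hk => c4At_of_c3At hP hk (h k hk)
  tfae_have 7 → 6 := fun h => ⟨1, le_rfl, h 1 le_rfl⟩
  tfae_have 4 → 6 := fun ⟨k, hk, h⟩ => ⟨k, hk, c4At_of_c3At hP hk h⟩
  tfae_have 6 → 1 := fun ⟨_, hk, h⟩ => c1At_of_c4At hP hk h
  tfae_have 1 ↔ 8 := exists_congr fun φ => exists_congr fun ψ => (t₂ φ ψ).out 0 2
  tfae_have 1 ↔ 9 := exists_congr fun φ => exists_congr fun ψ => (t₂ φ ψ).out 0 3
  tfae_have 1 ↔ 10 := exists_congr fun φ => exists_congr fun ψ => (t₂ φ ψ).out 0 4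
  tfae_have 1 ↔ 11 := exists_congr fun φ => (t₃ φ).out 0 2
  tfae_finish
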